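/- Let $x_{t+1}=A_{s_t}x_t+w_t$, $t\ge 0$, be a switched linear system with $x_t\in\mathbb R^n$, deterministic $x_0$, matrices $A_1,\dots,A_k\in\mathbb R^{n\times n}$ and noise $w_t\in\mathbb R^n$. The modes $s_t\in\{1,\dots,k\}$ are i.i.d. with $\Pr(s_t=i)=p_i\neq 0$, and each $s_t$ is independent of $(x_0,\dots,x_t,s_0,\dots,s_{t-1})$. Let $\mathcal F_{t-1}=\sigma(x_0,\dots,x_t,s_0,\dots,s_t)$, and let $\sigma_i$ be the largest singular value of $A_i$. Assume: 1. $\mathbb E\|w_t\|<\infty$ and $\mathbb E[w_t\mid\mathcal F_{t-1}]=0$ for all $t\ge 0$; there is a constant $\alpha>2$ with $\sup_{t\ge 0}\mathbb E[\|w_t\|^\alpha\mid\mathcal F_{t-1}]<\infty$ almost surely; and there is a (deterministic) symmetric positive definite matrix $C$ such that, almost surely, $\liminf_{T\to\infty}\frac1T\sum_{t=0}^{T-1}w_tw_t^{\top}\succeq C$, in the sense that $\liminf_{T\to\infty}\frac1T\sum_{t=0}^{T-1}(v^{\top}w_t)^2\ge v^{\top}Cv$ for every $v\in\mathbb R^n$.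 2. $\prod_{i=1}^k\sigma_i^{p_i}<1$. Let $\mathcal T_{i,T}=\{t\le T: s_t=i\}$ and let $\hat A_{i,T}$ be any minimizer of $B\mapsto\sum_{t\in\mathcal T_{i,T}}\|x_{t+1}-Bx_t\|^2$ over $B\in\mathbb R^{n\times n}$, where $\|\cdot\|$ is the Euclidean norm. Then for each $i\in\{1,\dots,k\}$, almost surely, as $T\to\infty$, $$\|\hat A_{i,T}-A_i\|_\infty=O\left(\sqrt{\frac{\log T}{|\mathcal T_{i,T}|}}\right),$$ where $\|M\|_\infty$ denotes the largest absolute value of an entry of $M$; the implied constant may depend on the realization. -/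

import Mathlib

open MeasureTheory ProbabilityTheory Filter Asymptotics

namespace SwitchedLS

noncomputable section

/-- The matrix `M` acting on Euclidean space. -/
def act {n : ℕ} (M : Matrix (Fin n) (Fin n) ℝ) :
    EuclideanSpace ℝ (Fin n) →L[ℝ] EuclideanSpace ℝ (Fin n) :=
  Matrix.toEuclideanCLM (n := Fin n) (𝕜 := ℝ) M

/-- The maximum singular value (spectral norm) of a matrix: the operator norm with respect to the
Euclidean norm. -/
def sigmaMax {n : ℕ} (M : Matrix (Fin n) (Fin n) ℝ) : ℝ := ‖act M‖

/-- The largest absolute value of an entry of a matrix. -/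
def maxEntry {n : ℕ} (M : Matrix (Fin n) (Fin n) ℝ) : ℝ :=
  ⨆ e : Fin n × Fin n, |M e.1 e.2|

/-- The history `σ(x_0, …, x_t, s_0, …, s_t)` of the complete state up to time `t`, usually
written `ℱ_{t-1}`. -/
@[reducible] def history {Ω : Type*} {n k : ℕ} (x : ℕ → Ω → EuclideanSpace ℝ (Fin n)) (s : ℕ → Ω → Fin k)
    (t : ℕ) : MeasurableSpace Ω :=
  (⨆ u ≤ t, MeasurableSpace.comap (x u) inferInstance) ⊔
    (⨆ u ≤ t, MeasurableSpace.comap (s u) inferInstance)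

/-- The information `σ(x_0, …, x_t, s_0, …, s_{t-1})` available just before the mode `s_t` is
drawn. -/
@[reducible] def historyBeforeSwitch {Ω : Type*} {n k : ℕ} (x : ℕ → Ω → EuclideanSpace ℝ (Fin n))
    (s : ℕ → Ω → Fin k) (t : ℕ) : MeasurableSpace Ω :=
  (⨆ u ≤ t, MeasurableSpace.comap (x u) inferInstance) ⊔
    (⨆ u < t, MeasurableSpace.comap (s u) inferInstance)

/-- An autonomous switched linear system `x_{t+1} = A_{s_t} x_t + w_t` with deterministic initial
state `x₀` and i.i.d. switching with law `p`, where all `p_i ≠ 0` and each mode `s_t` is drawn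
independently of the past. -/
structure IsSwitchedLinearSystem {Ω : Type*} [MeasurableSpace Ω] (μ : Measure Ω) {n k : ℕ}
    (A : Fin k → Matrix (Fin n) (Fin n) ℝ) (p : Fin k → ℝ) (x₀ : EuclideanSpace ℝ (Fin n))
    (s : ℕ → Ω → Fin k) (x w : ℕ → Ω → EuclideanSpace ℝ (Fin n)) : Prop where
  measurable_mode : ∀ t, Measurable (s t)
  measurable_noise : ∀ t, Measurable (w t)
  initial : ∀ ω, x 0 ω = x₀
  dynamics : ∀ t ω, x (t + 1) ω = act (A (s t ω)) (x t ω) + w t ω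
  mode_indep : iIndepFun s μ
  mode_law : ∀ t i, μ.real {ω | s t ω = i} = p i
  prob_ne_zero : ∀ i, p i ≠ 0
  mode_indep_past : ∀ t,
    Indep (MeasurableSpace.comap (s t) inferInstance) (historyBeforeSwitch x s t) μ

/-- The empirical noise covariance `(1/T) ∑_{t<T} w_t w_tᵀ`. -/
def noiseCov {Ω : Type*} {n : ℕ} (w : ℕ → Ω → EuclideanSpace ℝ (Fin n)) (T : ℕ) (ω : Ω) :
    Matrix (Fin n) (Fin n) ℝ :=
  (1 / (T : ℝ)) • ∑ t ∈ Finset.range T, Matrix.vecMulVec (w t ω).ofLp (w t ω).ofLp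

/-- The assumption on the noise: a martingale difference sequence with a.s. bounded conditional
moments of some order `α > 2`, whose empirical covariance has an a.s. positive definite lower limit.
The lower limit of matrices is taken in the order of quadratic forms, and only the lower bound `C`
on it is required. -/
structure NoiseAssumption {Ω : Type*} [MeasurableSpace Ω] (μ : Measure Ω) {n k : ℕ}
    (s : ℕ → Ω → Fin k) (x w : ℕ → Ω → EuclideanSpace ℝ (Fin n)) : Prop where
  integrable : ∀ t, Integrable (w t) μ
  martingale_difference : ∀ t, μ[w t | history x s t] =ᵐ[μ] 0
  moment : ∃ α : ℝ, 2 < α ∧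
    ∀ᵐ ω ∂μ, (⨆ t, (μ⁻[fun ω' => ‖w t ω'‖ₑ ^ α | history x s t]) ω) < ⊤
  excitation : ∃ C : Matrix (Fin n) (Fin n) ℝ, C.PosDef ∧ ∀ᵐ ω ∂μ, ∀ v : Fin n → ℝ,
    ((v ⬝ᵥ C.mulVec v : ℝ) : EReal) ≤
      liminf (fun T : ℕ => ((v ⬝ᵥ (noiseCov w T ω).mulVec v : ℝ) : EReal)) atTop

/-- The stability assumption `∏ σ_i ^ p_i < 1`. -/
def StabilityAssumption {n k : ℕ} (A : Fin k → Matrix (Fin n) (Fin n) ℝ) (p : Fin k → ℝ) : Prop :=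
  ∏ i, sigmaMax (A i) ^ p i < 1

/-- The set of times `t ≤ T` at which the mode equals `i`. -/
def visits {Ω : Type*} {k : ℕ} (s : ℕ → Ω → Fin k) (i : Fin k) (T : ℕ) (ω : Ω) : Finset ℕ :=
  {t ∈ Finset.range (T + 1) | s t ω = i}

/-- The least squares objective of mode `i` at time `T`. -/
def lsLoss {Ω : Type*} {n k : ℕ} (x : ℕ → Ω → EuclideanSpace ℝ (Fin n)) (s : ℕ → Ω → Fin k)
    (i : Fin k) (T : ℕ) (ω : Ω) (B : Matrix (Fin n) (Fin n) ℝ) : ℝ :=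
  ∑ t ∈ visits s i T ω, ‖x (t + 1) ω - act B (x t ω)‖ ^ 2

/-- `Ahat i T` is a switched least squares estimate of `A i`: a minimizer (any one, if there are
several) of the least squares objective over all matrices. -/
def IsSwitchedLeastSquares {Ω : Type*} {n k : ℕ} (x : ℕ → Ω → EuclideanSpace ℝ (Fin n))
    (s : ℕ → Ω → Fin k) (Ahat : Fin k → ℕ → Ω → Matrix (Fin n) (Fin n) ℝ) : Prop :=
  ∀ i T ω, IsMinOn (lsLoss x s i T ω) Set.univ (Ahat i T ω)

end

end SwitchedLS

namespace SwitchedLS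

open scoped ENNReal Topology

/-! ### Almost sure boundedness of martingale sums. -/

section BoundedSums

variable {Ω : Type*} {m0 : MeasurableSpace Ω} {μ : Measure Ω}

/-! For mode i, least squares is a regression on the masked regressors z_t = 1{s_t = i} x_t. Its
error is controlled by two quantities: the correlation of noise and regressors, measured in the
inverse Gram matrix, and the smallest eigenvalue of the Gram matrix. If the first is O(log T) and
the second at least cT, comparing the minimizer with A_i gives squared error O(log T / T)
(`sum_sq_error_le`, `sum_error_sq_le`), and at most T + 1 visits turn this into the stated rate.

Correlation. A rank one update of the Gram matrix splits its squared self-normalised size into a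
martingale, a quadratic noise term and a negative sum of squares (`selfNorm_eq`). The negative sum
absorbs the martingale, and the quadratic term is of the order of log det
(`IsNoise.ae_selfNorm_le`). The determinant is polynomial in T because the state is: the stability
assumption makes the mean of σ_i^θ smaller than 1 for some small θ (`exists_rpow_mean_lt_one`), so
fractional powers of the state norm satisfy a recursion contracting in mean
(`IsLocalNoise.ae_state_le`). No second moment stability is needed.

Gram matrix. On visits write x_{t+1} = A_{s_t} x_t + w_t. Since s_{t+1} is independent of everything
up to w_t, masking the noise covariance by 1{s_{t+1} = i} multiplies it by p_i up to o(T)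
(`IsLocalNoise.ae_thinned_cov_sub_le`). The cross terms are again noise against regressors and cost
only O(log T) (`sum_sq_add_two_mul_ge`). These regressors involve s_{t+1}, so the noise must remain
a martingale difference once that mode is revealed (`condExp_eq_zero_of_enlargement`). Together this
gives `IsLocalNoise.ae_design_ge`.

The conditional moments are bounded only by a random constant. Truncating where they exceed an
integer m gives countably many sequences with deterministic bounds, one of which agrees with the
noise on almost every path (`exists_localNoise`). -/

theorem exists_bound_of_tsum_enorm_ne_top {a : ℕ → ℝ} (h : ∑' t, ‖a t‖ₑ ≠ ∞) :
    ∃ C, ∀ T, |∑ t ∈ Finset.range T, a t| ≤ C := by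
  refine ⟨(∑' t, ‖a t‖ₑ).toReal, fun T => ?_⟩
  have h1 : ‖∑ t ∈ Finset.range T, a t‖ₑ ≤ ∑' t, ‖a t‖ₑ :=
    (enorm_sum_le _ _).trans (ENNReal.sum_le_tsum _)
  have h2 := ENNReal.toReal_mono h h1
  simpa using h2

theorem ae_exists_bound_of_tsum_lintegral {a : ℕ → Ω → ℝ}
    (ha : ∀ t, AEStronglyMeasurable (a t) μ) (h : ∑' t, ∫⁻ ω, ‖a t ω‖ₑ ∂μ ≠ ∞) :
    ∀ᵐ ω ∂μ, ∃ C, ∀ T, |∑ t ∈ Finset.range T, a t ω| ≤ C := by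
  rw [← lintegral_tsum (fun t => (ha t).enorm)] at h
  filter_upwards [ae_lt_top' (AEMeasurable.tsum fun t => (ha t).enorm) h] with ω hω
  exact exists_bound_of_tsum_enorm_ne_top hω.ne

/-- An `L²` bounded martingale built from bounded increments has bounded paths. -/
theorem ae_bounded_centered_sums_of_bounded [IsProbabilityMeasure μ] (𝒢 : Filtration ℕ m0)
    {b : ℕ → Ω → ℝ} (hmeas : ∀ t, StronglyMeasurable[𝒢 (t + 1)] (b t))
    (hb : ∀ t ω, |b t ω| ≤ 1) {S : ℝ}
    (hS : ∀ T, ∑ t ∈ Finset.range T, ∫ ω, b t ω ^ 2 ∂μ ≤ S) :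
    ∀ᵐ ω ∂μ, ∃ C, ∀ T, |∑ t ∈ Finset.range T, (b t ω - (μ[b t | 𝒢 t]) ω)| ≤ C := by
  have hbm : ∀ t, StronglyMeasurable (b t) := fun t => (hmeas t).mono (𝒢.le _)
  have hbint : ∀ t, Integrable (b t) μ := fun t =>
    Integrable.of_bound (hbm t).aestronglyMeasurable 1 (Eventually.of_forall fun ω => hb t ω)
  have he : ∀ t, ∀ᵐ ω ∂μ, |(μ[b t | 𝒢 t]) ω| ≤ 1 := fun t => by
    have := ae_bdd_abs_condExp_of_ae_bdd_abs (m := 𝒢 t) (R := 1) (μ := μ) (f := b t)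
      (Eventually.of_forall fun ω => by simpa using hb t ω)
    simpa using this
  set M : ℕ → Ω → ℝ := fun T ω => ∑ t ∈ Finset.range T, (b t ω - (μ[b t | 𝒢 t]) ω) with hM
  have hMsm : ∀ T, StronglyMeasurable[𝒢 T] (M T) := fun T => by
    refine Finset.stronglyMeasurable_fun_sum _ fun t ht => ?_
    have ht' := Finset.mem_range.1 ht
    exact ((hmeas t).mono (𝒢.mono ht')).sub (stronglyMeasurable_condExp.mono (𝒢.mono ht'.le))
  have hMb : ∀ T, ∀ᵐ ω ∂μ, |M T ω| ≤ 2 * T := fun T => by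
    filter_upwards [ae_all_iff.2 he] with ω hω
    calc |M T ω| ≤ ∑ t ∈ Finset.range T, |b t ω - (μ[b t | 𝒢 t]) ω| :=
          Finset.abs_sum_le_sum_abs _ _
      _ ≤ ∑ t ∈ Finset.range T, (2 : ℝ) := Finset.sum_le_sum fun t _ => by
          have h1 := abs_le.1 (hb t ω)
          have h2 := abs_le.1 (hω t)
          rw [abs_le]; constructor <;> linarith
      _ = 2 * T := by simp [mul_comm]
  have hMint : ∀ T, Integrable (M T) μ := fun T =>
    Integrable.of_bound ((hMsm T).mono (𝒢.le _)).aestronglyMeasurable (2 * T) (hMb T)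
  have hsucc : ∀ T, M (T + 1) = M T + (b T - μ[b T | 𝒢 T]) := fun T => by
    ext ω; simp only [hM, Finset.sum_range_succ, Pi.add_apply, Pi.sub_apply]
  have hmart : Martingale M 𝒢 μ := by
    refine martingale_nat (fun T => hMsm T) hMint fun T => ?_
    have h0 : μ[M (T + 1) | 𝒢 T] =ᵐ[μ] μ[M T | 𝒢 T] + μ[b T - μ[b T | 𝒢 T] | 𝒢 T] := by
      rw [hsucc]; exact condExp_add (hMint T) ((hbint T).sub integrable_condExp) _
    have h1 := condExp_sub (hbint T) (integrable_condExp (m := 𝒢 T) (f := b T) (μ := μ)) (𝒢 T)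
    have h2 : μ[M T | 𝒢 T] = M T := condExp_of_stronglyMeasurable (𝒢.le _) (hMsm T) (hMint T)
    have h3 : μ[μ[b T | 𝒢 T] | 𝒢 T] = μ[b T | 𝒢 T] :=
      condExp_of_stronglyMeasurable (𝒢.le _) stronglyMeasurable_condExp integrable_condExp
    filter_upwards [h0, h1] with ω h0 h1
    rw [h0]
    simp only [Pi.add_apply, h1, Pi.sub_apply, h2, h3]
    ring
  have hpull : ∀ T (c : Ω → ℝ), StronglyMeasurable[𝒢 T] c → ∀ R : ℝ, (∀ᵐ ω ∂μ, |c ω| ≤ R) →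
      ∫ ω, c ω * b T ω ∂μ = ∫ ω, c ω * (μ[b T | 𝒢 T]) ω ∂μ := fun T c hc R hR => by
    have hcb : Integrable (c * b T) μ :=
      (hbint T).bdd_mul (hc.mono (𝒢.le _)).aestronglyMeasurable hR
    have h1 := condExp_mul_of_stronglyMeasurable_left hc hcb (hbint T)
    have h2 := integral_condExp (μ := μ) (𝒢.le T) (f := c * b T)
    rw [integral_congr_ae h1] at h2
    exact h2.symm
  have hL2 : ∀ T, ∫ ω, M T ω ^ 2 ∂μ ≤ ∑ t ∈ Finset.range T, ∫ ω, b t ω ^ 2 ∂μ := by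
    intro T
    induction T with
    | zero => simp [hM]
    | succ T ih =>
      rw [Finset.sum_range_succ]
      set e := μ[b T | 𝒢 T] with hedef
      have hesm : StronglyMeasurable[𝒢 T] e := stronglyMeasurable_condExp
      have bd : ∀ f g : Ω → ℝ, AEStronglyMeasurable f μ → Integrable g μ → ∀ R : ℝ,
          (∀ᵐ ω ∂μ, |f ω| ≤ R) → Integrable (fun ω => f ω * g ω) μ :=
        fun f g hf hg R hR => hg.bdd_mul hf hR
      have me : AEStronglyMeasurable e μ := (hesm.mono (𝒢.le _)).aestronglyMeasurable
      have mM : AEStronglyMeasurable (M T) μ := ((hMsm T).mono (𝒢.le _)).aestronglyMeasurable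
      have i1 := bd _ _ mM (hMint T) _ (hMb T)
      have i2 := bd _ _ mM (hbint T) _ (hMb T)
      have i3 := bd _ _ mM (integrable_condExp : Integrable e μ) _ (hMb T)
      have i4 := bd _ _ (hbm T).aestronglyMeasurable (hbint T) 1 (Eventually.of_forall (hb T))
      have i5 := bd _ _ me (hbint T) _ (he T)
      have i6 := bd _ _ me (integrable_condExp : Integrable e μ) _ (he T)
      have e1 := hpull T (M T) (hMsm T) _ (hMb T)
      have e2 := hpull T e hesm _ (he T)
      have hexp : ∀ ω, M (T + 1) ω ^ 2 = (M T ω * M T ω + b T ω * b T ω)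
          + (2 * (M T ω * b T ω) - 2 * (M T ω * e ω)) - 2 * (e ω * b T ω) + e ω * e ω := fun ω => by
        -- After integration the terms in M cancel and E[e b] = E[e²], leaving E[M²] + E[b²] -
        -- E[e²]; the last term is dropped.
        rw [hsucc]; simp only [Pi.add_apply, Pi.sub_apply]; ring
      have hpos : 0 ≤ ∫ ω, e ω * e ω ∂μ := integral_nonneg fun ω => mul_self_nonneg _
      simp_rw [hexp]
      rw [integral_add, integral_sub, integral_add, integral_add, integral_sub,
        integral_const_mul, integral_const_mul, integral_const_mul, e1, e2]
      · simp_rw [pow_two] at ih ⊢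
        linarith
      all_goals first
        | exact i1 | exact i4 | exact i6 | exact i5.const_mul 2 | exact i2.const_mul 2
        | exact i3.const_mul 2 | exact i1.add i4 | exact (i2.const_mul 2).sub (i3.const_mul 2)
        | exact (i1.add i4).add ((i2.const_mul 2).sub (i3.const_mul 2))
        | exact ((i1.add i4).add ((i2.const_mul 2).sub (i3.const_mul 2))).sub (i5.const_mul 2)
  -- Doob's convergence theorem only asks for an L¹ bound, and |m| ≤ 1 + m² supplies it.
  have hL1 : ∀ T, eLpNorm (M T) 1 μ ≤ ((1 + S).toNNReal : ℝ≥0∞) := fun T => by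
    have hsq : Integrable (fun ω => M T ω ^ 2) μ := by
      simp_rw [pow_two]
      exact (hMint T).bdd_mul ((hMsm T).mono (𝒢.le _)).aestronglyMeasurable (hMb T)
    rw [eLpNorm_one_eq_lintegral_enorm, ← ofReal_integral_norm_eq_lintegral_enorm (hMint T)]
    refine ENNReal.ofReal_le_ofReal ?_
    calc ∫ ω, ‖M T ω‖ ∂μ ≤ ∫ ω, (1 + M T ω ^ 2) ∂μ := by
          refine integral_mono (hMint T).norm ((integrable_const 1).add hsq) fun ω => ?_
          simp only [Real.norm_eq_abs]
          nlinarith [sq_abs (M T ω), sq_nonneg (|M T ω| - 1), abs_nonneg (M T ω)]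
      _ = 1 + ∫ ω, M T ω ^ 2 ∂μ := by rw [integral_add (integrable_const 1) hsq]; simp
      _ ≤ 1 + S := by linarith [hL2 T, hS T]
  filter_upwards [hmart.submartingale.exists_ae_tendsto_of_bdd hL1] with ω ⟨c, hc⟩
  obtain ⟨C, hC⟩ := hc.abs.bddAbove_range
  exact ⟨C, fun T => hC ⟨T, rfl⟩⟩

/-- Centred sums of an adapted sequence with summable `p`-th moments, `1 ≤ p ≤ 2`, have bounded
paths. -/
theorem ae_bounded_centered_sums [IsProbabilityMeasure μ] (𝒢 : Filtration ℕ m0)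
    {d : ℕ → Ω → ℝ} (hmeas : ∀ t, StronglyMeasurable[𝒢 (t + 1)] (d t))
    (hint : ∀ t, Integrable (d t) μ) {p : ℝ} (hp1 : 1 ≤ p) (hp2 : p ≤ 2)
    (hsum : ∑' t, ∫⁻ ω, ‖d t ω‖ₑ ^ p ∂μ ≠ ∞) :
    ∀ᵐ ω ∂μ, ∃ C, ∀ T, |∑ t ∈ Finset.range T, (d t ω - (μ[d t | 𝒢 t]) ω)| ≤ C := by
  have hset : ∀ t, MeasurableSet[𝒢 (t + 1)] {ω | |d t ω| ≤ 1} := fun t =>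
    (hmeas t).norm.measurable measurableSet_Iic
  -- Truncation at 1: small values satisfy |d|² ≤ |d|^p because p ≤ 2, large ones |d| ≤ |d|^p
  -- because p ≥ 1. One series thus controls an L² martingale and an absolutely summable remainder.
  set b : ℕ → Ω → ℝ := fun t => {ω | |d t ω| ≤ 1}.indicator (d t) with hbdef
  set r : ℕ → Ω → ℝ := fun t => {ω | |d t ω| ≤ 1}ᶜ.indicator (d t) with hrdef
  have hbsm : ∀ t, StronglyMeasurable[𝒢 (t + 1)] (b t) := fun t => (hmeas t).indicator (hset t)
  have hrsm : ∀ t, StronglyMeasurable[𝒢 (t + 1)] (r t) :=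
    fun t => (hmeas t).indicator (hset t).compl
  have hbint : ∀ t, Integrable (b t) μ := fun t => (hint t).indicator (𝒢.le _ _ (hset t))
  have hrint : ∀ t, Integrable (r t) μ := fun t => (hint t).indicator (𝒢.le _ _ (hset t)).compl
  have hbr : ∀ t, d t = b t + r t := fun t => (Set.indicator_self_add_compl _ _).symm
  have hb1 : ∀ t ω, |b t ω| ≤ 1 := fun t ω => by
    by_cases h : |d t ω| ≤ 1
    · simp [hbdef, h]
    · simp [hbdef, h]
  have hbp : ∀ t ω, ‖b t ω‖ₑ ^ (2 : ℝ) ≤ ‖d t ω‖ₑ ^ p := fun t ω => by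
    by_cases h : |d t ω| ≤ 1
    · have h1 : ‖d t ω‖ₑ ≤ 1 := by
        rw [← ofReal_norm]; exact ENNReal.ofReal_le_one.2 h
      simpa [hbdef, h] using ENNReal.rpow_le_rpow_of_exponent_ge h1 hp2
    · simp [hbdef, h]
  have hrp : ∀ t ω, ‖r t ω‖ₑ ≤ ‖d t ω‖ₑ ^ p := fun t ω => by
    by_cases h : |d t ω| ≤ 1
    · simp [hrdef, h]
    · have h1 : 1 ≤ ‖d t ω‖ₑ := by
        rw [← ofReal_norm]; exact ENNReal.one_le_ofReal.2 (not_le.1 h).le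
      simpa [hrdef, h] using ENNReal.rpow_le_rpow_of_exponent_le h1 hp1
  have hrsum : ∑' t, ∫⁻ ω, ‖r t ω‖ₑ ∂μ ≠ ∞ :=
    ne_top_of_le_ne_top hsum (ENNReal.tsum_le_tsum fun t => lintegral_mono (hrp t))
  have hesum : ∑' t, ∫⁻ ω, ‖(μ[r t | 𝒢 t]) ω‖ₑ ∂μ ≠ ∞ := by
    refine ne_top_of_le_ne_top hrsum (ENNReal.tsum_le_tsum fun t => ?_)
    have := eLpNorm_condExp_le_eLpNorm (μ := μ) (m := 𝒢 t) (r t) le_rfl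
    simpa [eLpNorm_one_eq_lintegral_enorm] using this
  have hbS : ∀ T, ∑ t ∈ Finset.range T, ∫ ω, b t ω ^ 2 ∂μ ≤
      (∑' t, ∫⁻ ω, ‖d t ω‖ₑ ^ p ∂μ).toReal := fun T => by
    have h1 : ∀ t, ∫ ω, b t ω ^ 2 ∂μ = (∫⁻ ω, ‖b t ω‖ₑ ^ (2 : ℝ) ∂μ).toReal := fun t => by
      rw [integral_eq_lintegral_of_nonneg_ae (Eventually.of_forall fun ω => sq_nonneg _)
        (((hbsm t).mono (𝒢.le _)).pow 2).aestronglyMeasurable]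
      congr 1
      refine lintegral_congr fun ω => ?_
      rw [← ofReal_norm, Real.norm_eq_abs, ENNReal.ofReal_rpow_of_nonneg (abs_nonneg _) zero_le_two]
      congr 1
      rw [Real.rpow_two, sq_abs]
    simp_rw [h1]
    have h2 : ∀ t, ∫⁻ ω, ‖b t ω‖ₑ ^ (2 : ℝ) ∂μ ≤ ∫⁻ ω, ‖d t ω‖ₑ ^ p ∂μ :=
      fun t => lintegral_mono (hbp t)
    rw [← ENNReal.toReal_sum fun t _ =>
      ne_top_of_le_ne_top hsum ((h2 t).trans (ENNReal.le_tsum t))]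
    exact ENNReal.toReal_mono hsum ((Finset.sum_le_sum fun t _ => h2 t).trans
      (ENNReal.sum_le_tsum _))
  have hce : ∀ t, μ[d t | 𝒢 t] =ᵐ[μ] μ[b t | 𝒢 t] + μ[r t | 𝒢 t] := fun t => by
    rw [hbr t]; exact condExp_add (hbint t) (hrint t) _
  filter_upwards [ae_bounded_centered_sums_of_bounded 𝒢 hbsm hb1 hbS,
    ae_exists_bound_of_tsum_lintegral (fun t => (hrint t).aestronglyMeasurable) hrsum,
    ae_exists_bound_of_tsum_lintegral
      (fun t => (integrable_condExp (f := r t) (m := 𝒢 t)).aestronglyMeasurable) hesum,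
    ae_all_iff.2 hce] with ω ⟨C₁, h1⟩ ⟨C₂, h2⟩ ⟨C₃, h3⟩ hω
  refine ⟨C₁ + C₂ + C₃, fun T => ?_⟩
  have : ∑ t ∈ Finset.range T, (d t ω - (μ[d t | 𝒢 t]) ω) =
      ∑ t ∈ Finset.range T, (b t ω - (μ[b t | 𝒢 t]) ω) + ∑ t ∈ Finset.range T, r t ω
        - ∑ t ∈ Finset.range T, (μ[r t | 𝒢 t]) ω := by
    rw [← Finset.sum_add_distrib, ← Finset.sum_sub_distrib]
    refine Finset.sum_congr rfl fun t _ => ?_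
    rw [hω t, hbr t]; simp only [Pi.add_apply]; ring
  rw [this]
  refine (abs_sub _ _).trans (add_le_add ((abs_add_le _ _).trans (add_le_add (h1 T) (h2 T))) (h3 T))

/-- Summation by parts: weighting bounded partial sums by a monotone sequence. -/
theorem abs_sum_mul_le_of_bounded {K d : ℕ → ℝ} (hK0 : 0 ≤ K 0) (hK : Monotone K) {C : ℝ}
    (h : ∀ T, |∑ t ∈ Finset.range T, d t| ≤ C) (T : ℕ) :
    |∑ t ∈ Finset.range T, K (t + 1) * d t| ≤ 2 * C * K T := by
  have hC : 0 ≤ C := (abs_nonneg _).trans (h 0)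
  -- The Abel remainder grows by at most C (K (T+1) - K T) at each step, so its bound telescopes.
  have key : ∀ T, |∑ t ∈ Finset.range T, K (t + 1) * d t - K T * ∑ t ∈ Finset.range T, d t| ≤
      C * (K T - K 0) := by
    intro T
    induction T with
    | zero => simp
    | succ T ih =>
      have h1 : ∑ t ∈ Finset.range (T + 1), K (t + 1) * d t
          - K (T + 1) * ∑ t ∈ Finset.range (T + 1), d t =
          (∑ t ∈ Finset.range T, K (t + 1) * d t - K T * ∑ t ∈ Finset.range T, d t)
          - (K (T + 1) - K T) * ∑ t ∈ Finset.range T, d t := by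
        rw [Finset.sum_range_succ, Finset.sum_range_succ]; ring
      rw [h1]
      refine (abs_sub _ _).trans ?_
      have hd : 0 ≤ K (T + 1) - K T := sub_nonneg.2 (hK T.le_succ)
      rw [abs_mul, abs_of_nonneg hd]
      nlinarith [mul_le_mul_of_nonneg_left (h T) hd]
  have hKT : 0 ≤ K T := hK0.trans (hK (Nat.zero_le T))
  have h2 : |K T * ∑ t ∈ Finset.range T, d t| ≤ K T * C := by
    rw [abs_mul, abs_of_nonneg hKT]; exact mul_le_mul_of_nonneg_left (h T) hKT
  have h3 := key T
  have h4 := abs_add_le (∑ t ∈ Finset.range T, K (t + 1) * d t - K T * ∑ t ∈ Finset.range T, d t)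
    (K T * ∑ t ∈ Finset.range T, d t)
  rw [sub_add_cancel] at h4
  nlinarith [mul_nonneg hC hK0]

/-- The hypothesis compares two measures on `m`: the trace of `μ.withDensity f` is at most M times
that of μ. This is E[f | m] ≤ M in a form that avoids conditional expectations. -/
theorem lintegral_mul_le_of_forall_setLIntegral_le {Ω : Type*} {m m0 : MeasurableSpace Ω}
    {μ : Measure Ω} (hm : m ≤ m0) {f g : Ω → ℝ≥0∞} (hf : Measurable f) {M : ℝ≥0∞}
    (h : ∀ s, MeasurableSet[m] s → ∫⁻ ω in s, f ω ∂μ ≤ M * μ s) (hg : Measurable[m] g) :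
    ∫⁻ ω, g ω * f ω ∂μ ≤ M * ∫⁻ ω, g ω ∂μ := by
  have h1 : ∫⁻ ω, g ω * f ω ∂μ = ∫⁻ ω, g ω ∂((μ.withDensity f).trim hm) := by
    rw [lintegral_trim hm hg, lintegral_withDensity_eq_lintegral_mul _ hf (hg.mono hm le_rfl)]
    simp [mul_comm]
  have h2 : ∫⁻ ω, g ω ∂μ = ∫⁻ ω, g ω ∂(μ.trim hm) := (lintegral_trim hm hg).symm
  rw [h1, h2, ← smul_eq_mul, ← lintegral_smul_measure]
  refine lintegral_mono' ?_ le_rfl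
  refine Measure.le_iff.2 fun s hs => ?_
  rw [trim_measurableSet_eq hm hs, withDensity_apply _ (hm _ hs), Measure.smul_apply,
    trim_measurableSet_eq hm hs]
  exact h s hs

/-- Growth of a weighted centred sum: the weights are predictable and the normalisation `K` makes
their `p`-th powers summable. -/
theorem ae_weighted_centered_sums_le [IsProbabilityMeasure μ] (𝒢 : Filtration ℕ m0)
    {y g K : ℕ → Ω → ℝ} (hy : ∀ t, StronglyMeasurable[𝒢 (t + 1)] (y t))
    (hyint : ∀ t, Integrable (y t) μ) {p : ℝ} (hp1 : 1 ≤ p) (hp2 : p ≤ 2) {M : ℝ≥0∞} (hM : M ≠ ∞)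
    (hmom : ∀ t s, MeasurableSet[𝒢 t] s → ∫⁻ ω in s, ‖y t ω‖ₑ ^ p ∂μ ≤ M * μ s)
    (hg : ∀ t, StronglyMeasurable[𝒢 t] (g t)) (hK : ∀ t, StronglyMeasurable[𝒢 t] (K (t + 1)))
    (hKpos : ∀ t ω, 0 < K t ω) (hKmono : ∀ ω, Monotone fun t => K t ω) {B : ℝ}
    (hB : ∀ T ω, ∑ t ∈ Finset.range T, (|g t ω| / K (t + 1) ω) ^ p ≤ B) :
    ∀ᵐ ω ∂μ, ∃ C, ∀ T, |∑ t ∈ Finset.range T, g t ω * (y t ω - (μ[y t | 𝒢 t]) ω)| ≤ C * K T ω := by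
  have hp0 : 0 < p := by linarith
  set u : ℕ → Ω → ℝ := fun t ω => g t ω / K (t + 1) ω with hu
  have husm : ∀ t, StronglyMeasurable[𝒢 t] (u t) := fun t =>
    ((hg t).measurable.div (hK t).measurable).stronglyMeasurable
  have habs : ∀ t ω, |u t ω| = |g t ω| / K (t + 1) ω := fun t ω => by
    rw [hu]; simp only; rw [abs_div, abs_of_pos (hKpos _ _)]
  have hup : ∀ t ω, |u t ω| ^ p ≤ B := fun t ω => by
    rw [habs]
    refine le_trans ?_ (hB (t + 1) ω)
    exact Finset.single_le_sum (f := fun t => (|g t ω| / K (t + 1) ω) ^ p)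
      (fun i _ => Real.rpow_nonneg (div_nonneg (abs_nonneg _) (hKpos _ _).le) _)
      (Finset.self_mem_range_succ t)
  have hub : ∀ t ω, |u t ω| ≤ B ^ p⁻¹ := fun t ω =>
    calc |u t ω| = (|u t ω| ^ p) ^ p⁻¹ := (Real.rpow_rpow_inv (abs_nonneg _) hp0.ne').symm
      _ ≤ _ := Real.rpow_le_rpow (Real.rpow_nonneg (abs_nonneg _) _) (hup t ω) (by positivity)
  have hdint : ∀ t, Integrable (u t * y t) μ := fun t =>
    (hyint t).bdd_mul ((husm t).mono (𝒢.le _)).aestronglyMeasurable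
      (Eventually.of_forall (hub t))
  -- Predictability of u lets the conditional moment bound pull out M, and the pathwise bound B on
  -- the sum of |u|^p does the rest.
  have hsum : ∑' t, ∫⁻ ω, ‖(u t * y t) ω‖ₑ ^ p ∂μ ≠ ∞ := by
    have h1 : ∀ t, ∫⁻ ω, ‖(u t * y t) ω‖ₑ ^ p ∂μ ≤ M * ∫⁻ ω, ‖u t ω‖ₑ ^ p ∂μ := fun t => by
      have := lintegral_mul_le_of_forall_setLIntegral_le (μ := μ) (𝒢.le t)
        (f := fun ω => ‖y t ω‖ₑ ^ p) (g := fun ω => ‖u t ω‖ₑ ^ p)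
        ((((hy t).mono (𝒢.le _)).enorm).pow_const p) (hmom t) ((husm t).enorm.pow_const p)
      refine le_trans (le_of_eq (lintegral_congr fun ω => ?_)) this
      rw [Pi.mul_apply, enorm_mul, ENNReal.mul_rpow_of_nonneg _ _ hp0.le]
    refine ne_top_of_le_ne_top ?_ (ENNReal.tsum_le_tsum h1)
    rw [ENNReal.tsum_mul_left, ← lintegral_tsum fun t =>
      (((husm t).mono (𝒢.le _)).enorm.pow_const p).aemeasurable]
    refine ENNReal.mul_ne_top hM (ne_top_of_le_ne_top (b := ENNReal.ofReal B)
      ENNReal.ofReal_ne_top ?_)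
    calc ∫⁻ ω, ∑' t, ‖u t ω‖ₑ ^ p ∂μ ≤ ∫⁻ _, ENNReal.ofReal B ∂μ := by
          refine lintegral_mono fun ω => ?_
          rw [ENNReal.tsum_eq_iSup_nat]
          refine iSup_le fun T => ?_
          have : ∀ t, ‖u t ω‖ₑ ^ p = ENNReal.ofReal ((|g t ω| / K (t + 1) ω) ^ p) := fun t => by
            rw [← ofReal_norm, Real.norm_eq_abs, ENNReal.ofReal_rpow_of_nonneg (abs_nonneg _) hp0.le,
              habs]
          simp_rw [this]
          rw [← ENNReal.ofReal_sum_of_nonneg fun t _ =>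
            Real.rpow_nonneg (div_nonneg (abs_nonneg _) (hKpos _ _).le) _]
          exact ENNReal.ofReal_le_ofReal (hB T ω)
      _ = ENNReal.ofReal B := by simp
  have hce : ∀ t, μ[u t * y t | 𝒢 t] =ᵐ[μ] u t * μ[y t | 𝒢 t] := fun t =>
    condExp_mul_of_stronglyMeasurable_left (husm t) (hdint t) (hyint t)
  filter_upwards [ae_bounded_centered_sums 𝒢
    (fun t => ((husm t).mono (𝒢.mono t.le_succ)).mul (hy t)) hdint hp1 hp2 hsum,
    ae_all_iff.2 hce] with ω ⟨C, hC⟩ hω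
  refine ⟨2 * C, fun T => ?_⟩
  have := abs_sum_mul_le_of_bounded (K := fun t => K t ω) (hKpos 0 ω).le (hKmono ω) hC T
  refine le_trans (le_of_eq ?_) this
  congr 1
  refine Finset.sum_congr rfl fun t _ => ?_
  rw [hω t]
  simp only [Pi.mul_apply, hu]
  field_simp [(hKpos (t + 1) ω).ne']

end BoundedSums

/-! ### Gram matrix, self-normalised correlation and determinant. -/

section Recursion

open Matrix

variable {n : ℕ}

/-- The regularised Gram matrix `1 + ∑_{t<T} z_t z_tᵀ`. -/
def gram (z : ℕ → Fin n → ℝ) (T : ℕ) : Matrix (Fin n) (Fin n) ℝ :=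
  1 + ∑ t ∈ Finset.range T, vecMulVec (z t) (z t)

/-- The correlation `∑_{t<T} η_t z_t` of a scalar noise with the regressors. -/
def corr (z : ℕ → Fin n → ℝ) (η : ℕ → ℝ) (T : ℕ) : Fin n → ℝ :=
  ∑ t ∈ Finset.range T, η t • z t

/-- The squared norm of `corr` in the inverse Gram matrix. -/
noncomputable def selfNorm (z : ℕ → Fin n → ℝ) (η : ℕ → ℝ) (T : ℕ) : ℝ :=
  corr z η T ⬝ᵥ (gram z T)⁻¹ *ᵥ corr z η T

/-- The squared norm of the new regressor in the inverse of the old Gram matrix. -/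
noncomputable def leverage (z : ℕ → Fin n → ℝ) (t : ℕ) : ℝ := z t ⬝ᵥ (gram z t)⁻¹ *ᵥ z t

/-- The prediction of the new observation by the past least squares fit. -/
noncomputable def prediction (z : ℕ → Fin n → ℝ) (η : ℕ → ℝ) (t : ℕ) : ℝ :=
  z t ⬝ᵥ (gram z t)⁻¹ *ᵥ corr z η t

theorem gram_succ (z : ℕ → Fin n → ℝ) (T : ℕ) :
    gram z (T + 1) = gram z T + vecMulVec (z T) (z T) := by
  simp [gram, Finset.sum_range_succ, add_assoc]

theorem corr_succ (z : ℕ → Fin n → ℝ) (η : ℕ → ℝ) (T : ℕ) :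
    corr z η (T + 1) = corr z η T + η T • z T := by
  simp [corr, Finset.sum_range_succ]

theorem gram_posDef (z : ℕ → Fin n → ℝ) (T : ℕ) : (gram z T).PosDef :=
  PosDef.one.add_posSemidef <| Matrix.posSemidef_sum _ fun t _ => by
    simpa using posSemidef_vecMulVec_self_star (z t)

theorem gram_isUnit_det (z : ℕ → Fin n → ℝ) (T : ℕ) : IsUnit (gram z T).det :=
  (gram_posDef z T).det_pos.ne'.isUnit

theorem gram_inv_comm (z : ℕ → Fin n → ℝ) (T : ℕ) (u v : Fin n → ℝ) :
    u ⬝ᵥ (gram z T)⁻¹ *ᵥ v = v ⬝ᵥ (gram z T)⁻¹ *ᵥ u := by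
  have h : ((gram z T)⁻¹)ᵀ = (gram z T)⁻¹ := by
    simpa [IsHermitian, conjTranspose_eq_transpose_of_trivial] using (gram_posDef z T).inv.1
  conv_lhs => rw [dotProduct_mulVec, ← mulVec_transpose, h, dotProduct_comm]

theorem leverage_nonneg (z : ℕ → Fin n → ℝ) (t : ℕ) : 0 ≤ leverage z t := by
  simpa [leverage] using (gram_posDef z t).inv.posSemidef.dotProduct_mulVec_nonneg (z t)

theorem selfNorm_nonneg (z : ℕ → Fin n → ℝ) (η : ℕ → ℝ) (T : ℕ) : 0 ≤ selfNorm z η T := by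
  simpa [selfNorm] using (gram_posDef z T).inv.posSemidef.dotProduct_mulVec_nonneg (corr z η T)

/-- The Sherman-Morrison formula for the Gram matrix, in bilinear form. -/
theorem dotProduct_gram_succ_inv (z : ℕ → Fin n → ℝ) (t : ℕ) (u v : Fin n → ℝ) :
    u ⬝ᵥ (gram z (t + 1))⁻¹ *ᵥ v = u ⬝ᵥ (gram z t)⁻¹ *ᵥ v
      - (u ⬝ᵥ (gram z t)⁻¹ *ᵥ z t) * (v ⬝ᵥ (gram z t)⁻¹ *ᵥ z t) / (1 + leverage z t) := by
  have hpos : 0 < 1 + leverage z t := by linarith [leverage_nonneg z t]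
  set P := (gram z t)⁻¹ with hP
  set y := P *ᵥ z t with hy
  have hVP : gram z t * P = 1 := mul_nonsing_inv _ (gram_isUnit_det z t)
  have hzP : z t ᵥ* P = y := by
    ext j
    have := gram_inv_comm z t (z t) (Pi.single j 1)
    rw [← hP, dotProduct_mulVec] at this
    simpa using this
  -- The Sherman-Morrison candidate is verified by multiplying it with the updated matrix.
  have hinv : (gram z (t + 1))⁻¹ = P - (1 + leverage z t)⁻¹ • vecMulVec y y := by
    refine inv_eq_right_inv ?_
    have h1 : gram z t *ᵥ y = z t := by rw [hy, mulVec_mulVec, hVP, one_mulVec]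
    have h2 : z t ⬝ᵥ y = leverage z t := rfl
    rw [gram_succ, mul_sub, add_mul, hVP, mul_smul_comm, add_mul, mul_vecMulVec, h1,
      vecMulVec_mul, hzP, vecMulVec_mul_vecMulVec, h2, vecMulVec_smul]
    ext i j
    simp only [Matrix.sub_apply, Matrix.add_apply, Matrix.smul_apply, smul_eq_mul]
    field_simp
    ring
  rw [hinv, sub_mulVec, smul_mulVec, vecMulVec_mulVec, dotProduct_sub, dotProduct_smul]
  have h3 : y ⬝ᵥ v = v ⬝ᵥ y := dotProduct_comm _ _
  simp [h3]
  field_simp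

theorem selfNorm_succ (z : ℕ → Fin n → ℝ) (η : ℕ → ℝ) (t : ℕ) :
    selfNorm z η (t + 1) = selfNorm z η t +
      (2 * η t * prediction z η t + η t ^ 2 * leverage z t - prediction z η t ^ 2)
        / (1 + leverage z t) := by
  have hpos : 0 < 1 + leverage z t := by linarith [leverage_nonneg z t]
  have h1 : corr z η t ⬝ᵥ (gram z t)⁻¹ *ᵥ z t = prediction z η t := gram_inv_comm z t _ _
  have h2 : z t ⬝ᵥ (gram z t)⁻¹ *ᵥ z t = leverage z t := rfl
  have h3 : corr z η t ⬝ᵥ (gram z t)⁻¹ *ᵥ corr z η t = selfNorm z η t := rfl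
  have h4 : z t ⬝ᵥ (gram z t)⁻¹ *ᵥ corr z η t = prediction z η t := rfl
  rw [selfNorm, dotProduct_gram_succ_inv, corr_succ]
  simp only [add_dotProduct, smul_dotProduct, mulVec_add, mulVec_smul, dotProduct_add,
    dotProduct_smul, h1, h2, h3, h4, smul_eq_mul]
  field_simp
  ring

/-- Summing `selfNorm_succ` from zero. The negative sum of squared predictions is kept because it
later pays for the first sum, a martingale transform with essentially the same squared weights. -/
theorem selfNorm_eq (z : ℕ → Fin n → ℝ) (η : ℕ → ℝ) (T : ℕ) :
    selfNorm z η T = 2 * ∑ t ∈ Finset.range T, prediction z η t / (1 + leverage z t) * η t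
      + ∑ t ∈ Finset.range T, leverage z t / (1 + leverage z t) * η t ^ 2
      - ∑ t ∈ Finset.range T, prediction z η t ^ 2 / (1 + leverage z t) := by
  induction T with
  | zero => simp [selfNorm, corr]
  | succ T ih =>
    rw [selfNorm_succ, ih, Finset.sum_range_succ, Finset.sum_range_succ, Finset.sum_range_succ]
    ring

/-- Cauchy-Schwarz in the norm of the Gram matrix. -/
theorem dotProduct_corr_sq_le (z : ℕ → Fin n → ℝ) (η : ℕ → ℝ) (T : ℕ) (v : Fin n → ℝ) :
    (v ⬝ᵥ corr z η T) ^ 2 ≤ (v ⬝ᵥ gram z T *ᵥ v) * selfNorm z η T := by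
  set Q := corr z η T
  set V := gram z T with hV
  set u := V⁻¹ *ᵥ Q with hu
  have hVu : V *ᵥ u = Q := by
    rw [hu, mulVec_mulVec, mul_nonsing_inv _ (gram_isUnit_det z T), one_mulVec]
  have hq : u ⬝ᵥ Q = selfNorm z η T := dotProduct_comm _ _
  have hsymm : u ⬝ᵥ V *ᵥ v = v ⬝ᵥ Q := by
    have h : Vᵀ = V := by
      simpa [IsHermitian, conjTranspose_eq_transpose_of_trivial] using (gram_posDef z T).1
    rw [dotProduct_mulVec, ← mulVec_transpose, h, hVu, dotProduct_comm]
  -- This quadratic in s is the Gram form at v + s u with u = V⁻¹ Q; its discriminant is the claim.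
  have hnn : ∀ s : ℝ, 0 ≤ (selfNorm z η T) * (s * s) + (2 * (v ⬝ᵥ Q)) * s + v ⬝ᵥ V *ᵥ v := by
    intro s
    have h := (gram_posDef z T).posSemidef.dotProduct_mulVec_nonneg (v + s • u)
    simp only [star_trivial, ← hV, mulVec_add, mulVec_smul, hVu, add_dotProduct, dotProduct_add,
      smul_dotProduct, dotProduct_smul, hq, hsymm, smul_eq_mul] at h
    linarith
  have := discrim_le_zero hnn
  rw [discrim] at this
  linarith

theorem dotProduct_gram_mulVec (z : ℕ → Fin n → ℝ) (T : ℕ) (v : Fin n → ℝ) :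
    v ⬝ᵥ gram z T *ᵥ v = v ⬝ᵥ v + ∑ t ∈ Finset.range T, (v ⬝ᵥ z t) ^ 2 := by
  induction T with
  | zero => simp [gram]
  | succ T ih =>
    rw [gram_succ, add_mulVec, dotProduct_add, ih, Finset.sum_range_succ, vecMulVec_mulVec,
      add_assoc]
    congr 2
    simp [dotProduct_comm (z T) v, pow_two]

/-- The matrix determinant lemma for a rank one update; it turns log det into a telescoping sum of
log(1 + leverage). -/
theorem det_gram_succ (z : ℕ → Fin n → ℝ) (t : ℕ) :
    (gram z (t + 1)).det = (gram z t).det * (1 + leverage z t) := by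
  rw [gram_succ, vecMulVec_eq Unit, det_add_replicateCol_mul_replicateRow (gram_isUnit_det z t)]
  congr 1
  rw [det_unique, Matrix.add_apply, one_apply_eq, leverage, Matrix.mul_assoc]
  rfl

/-- Each summand is 1 - 1/(1 + leverage), which is at most log(1 + leverage), the increment of log
det. -/
theorem sum_leverage_le_log_det (z : ℕ → Fin n → ℝ) (T : ℕ) :
    ∑ t ∈ Finset.range T, leverage z t / (1 + leverage z t) ≤ Real.log (gram z T).det := by
  induction T with
  | zero => simp [gram]
  | succ T ih =>
    have h0 := leverage_nonneg z T
    have hpos : 0 < 1 + leverage z T := by linarith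
    rw [Finset.sum_range_succ, det_gram_succ,
      Real.log_mul (gram_posDef z T).det_pos.ne' hpos.ne']
    have := Real.one_sub_inv_le_log_of_pos hpos
    have h2 : leverage z T / (1 + leverage z T) = 1 - (1 + leverage z T)⁻¹ := by field_simp; ring
    linarith

/-- The Leibniz expansion with a bound on the entries suffices, as only the order of the logarithm
matters. -/
theorem log_det_gram_le (z : ℕ → Fin n → ℝ) (T : ℕ) {R : ℝ} (hR : 1 ≤ R)
    (h : ∀ t < T, ∀ j, |z t j| ≤ R) :
    Real.log (gram z T).det ≤
      Real.log (Nat.factorial n) + n * Real.log ((T + 1) * R ^ 2) := by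
  have hent : ∀ i j, |gram z T i j| ≤ (T + 1) * R ^ 2 := by
    intro i j
    rw [gram, Matrix.add_apply, Matrix.sum_apply]
    have h1 : |(1 : Matrix (Fin n) (Fin n) ℝ) i j| ≤ R ^ 2 := by
      rw [one_apply]
      split_ifs
      · rw [abs_one]; nlinarith
      · rw [abs_zero]; positivity
    have h2 : |∑ t ∈ Finset.range T, vecMulVec (z t) (z t) i j| ≤ T * R ^ 2 := by
      refine (Finset.abs_sum_le_sum_abs _ _).trans ?_
      refine (Finset.sum_le_card_nsmul _ _ (R ^ 2) fun t ht => ?_).trans (by simp)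
      have ht' := Finset.mem_range.1 ht
      rw [vecMulVec_apply, abs_mul, pow_two]
      exact mul_le_mul (h t ht' i) (h t ht' j) (abs_nonneg _) (by linarith)
    refine (abs_add_le _ _).trans ?_
    linarith
  have hdet := Matrix.det_le (abv := AbsoluteValue.abs) (A := gram z T) (x := (T + 1) * R ^ 2) hent
  have hpos := (gram_posDef z T).det_pos
  have hx : 0 < ((T : ℝ) + 1) * R ^ 2 := by positivity
  have hd : (gram z T).det ≤ (Nat.factorial n : ℝ) * ((T + 1) * R ^ 2) ^ n := by
    refine (le_abs_self _).trans ?_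
    simpa using hdet
  refine (Real.log_le_log hpos hd).trans ?_
  rw [Real.log_mul (by positivity) (by positivity), Real.log_pow]

end Recursion

/-! ### A discrete integral test. -/

section Series

/-- The right side is the integral of u^(-1-δ) over [x, y], whose integrand is smallest at y. The
proof replaces the integral by exp a ≥ 1 + a and log r ≤ r - 1. -/
theorem div_rpow_le_sub {x y δ : ℝ} (hx : 0 < x) (hxy : x ≤ y) (hδ : 0 < δ) :
    (y - x) / y ^ (1 + δ) ≤ (x ^ (-δ) - y ^ (-δ)) / δ := by
  have hy : 0 < y := hx.trans_le hxy
  rw [le_div_iff₀ hδ]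
  have h1 : x ^ (-δ) = y ^ (-δ) * (x / y) ^ (-δ) := by
    rw [Real.div_rpow hx.le hy.le]; field_simp
  have h2 : (1 : ℝ) + δ * (1 - x / y) ≤ (x / y) ^ (-δ) := by
    rw [Real.rpow_def_of_pos (by positivity)]
    have := Real.add_one_le_exp (Real.log (x / y) * -δ)
    have := Real.log_le_sub_one_of_pos (show 0 < x / y by positivity)
    nlinarith
  have h3 : (y - x) / y ^ (1 + δ) = y ^ (-δ) * (1 - x / y) := by
    rw [Real.rpow_add hy, Real.rpow_one, Real.rpow_neg hy.le]; field_simp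
  have h4 : 0 < y ^ (-δ) := Real.rpow_pos_of_pos hy _
  rw [h1, h3]
  nlinarith

/-- The discrete integral test behind all normalisations. -/
theorem sum_div_rpow_le {u : ℕ → ℝ} (hu : ∀ t, 0 ≤ u t) {q : ℝ} (hq : 1 < q) (T : ℕ) :
    ∑ t ∈ Finset.range T, u t / (1 + ∑ i ∈ Finset.range (t + 1), u i) ^ q ≤ 1 / (q - 1) := by
  have hS : ∀ t, 0 < 1 + ∑ i ∈ Finset.range t, u i := fun t => by
    have := Finset.sum_nonneg (s := Finset.range t) fun i _ => hu i
    linarith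
  have key : ∀ T, ∑ t ∈ Finset.range T, u t / (1 + ∑ i ∈ Finset.range (t + 1), u i) ^ q ≤
      (1 - (1 + ∑ i ∈ Finset.range T, u i) ^ (-(q - 1))) / (q - 1) := by
    intro T
    induction T with
    | zero => simp
    | succ T ih =>
      rw [Finset.sum_range_succ]
      have := div_rpow_le_sub (δ := q - 1) (hS T) (y := 1 + ∑ i ∈ Finset.range (T + 1), u i)
        (by rw [Finset.sum_range_succ]; linarith [hu T]) (by linarith)
      have h2 : 1 + ∑ i ∈ Finset.range (T + 1), u i - (1 + ∑ i ∈ Finset.range T, u i) = u T := by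
        rw [Finset.sum_range_succ]; ring
      rw [h2, add_sub_cancel] at this
      refine (add_le_add ih this).trans (le_of_eq ?_)
      ring
  refine (key T).trans (div_le_div_of_nonneg_right ?_ (by linarith))
  have := Real.rpow_nonneg (hS T).le (-(q - 1))
  linarith

end Series

/-! ### Martingale estimates for scalar noise. -/

section Noise

variable {Ω : Type*} {m0 : MeasurableSpace Ω}

/-- A scalar martingale difference sequence whose conditional moments of order `α` are bounded by
the constant `M`. -/
structure IsNoise (μ : Measure Ω) (𝒢 : Filtration ℕ m0) (α : ℝ) (M : ℝ≥0∞) (η : ℕ → Ω → ℝ) :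
    Prop where
  adapted : ∀ t, StronglyMeasurable[𝒢 (t + 1)] (η t)
  integrable : ∀ t, Integrable (η t) μ
  condExp_eq_zero : ∀ t, μ[η t | 𝒢 t] =ᵐ[μ] 0
  moment : ∀ t s, MeasurableSet[𝒢 t] s → ∫⁻ ω in s, ‖η t ω‖ₑ ^ α ∂μ ≤ M * μ s

variable {μ : Measure Ω} {𝒢 : Filtration ℕ m0} {α : ℝ} {M : ℝ≥0∞} {η : ℕ → Ω → ℝ}

theorem rpow_le_one_add_rpow {x : ℝ≥0∞} {a b : ℝ} (ha : 0 ≤ a) (hab : a ≤ b) :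
    x ^ a ≤ 1 + x ^ b := by
  rcases le_total x 1 with h | h
  · exact (ENNReal.rpow_le_one h ha).trans le_self_add
  · exact (ENNReal.rpow_le_rpow_of_exponent_le h hab).trans le_add_self

theorem setLIntegral_rpow_le_of_le {E : Type*} [NormedAddCommGroup E] {f : Ω → E}
    {a b : ℝ} (ha : 0 ≤ a) (hab : a ≤ b) {s : Set Ω}
    (h : ∫⁻ ω in s, ‖f ω‖ₑ ^ b ∂μ ≤ M * μ s) :
    ∫⁻ ω in s, ‖f ω‖ₑ ^ a ∂μ ≤ (1 + M) * μ s :=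
  calc ∫⁻ ω in s, ‖f ω‖ₑ ^ a ∂μ ≤ ∫⁻ ω in s, (1 + ‖f ω‖ₑ ^ b) ∂μ :=
        lintegral_mono fun ω => rpow_le_one_add_rpow ha hab
    _ = μ s + ∫⁻ ω in s, ‖f ω‖ₑ ^ b ∂μ := by
        rw [lintegral_add_left measurable_const]; simp
    _ ≤ (1 + M) * μ s := by rw [add_mul, one_mul]; gcongr

/-- A nonnegative variable with bounded integrals on all sets of a `σ`-algebra has a bounded
conditional expectation. -/
theorem ae_condExp_le_of_forall_setLIntegral_le {Ω : Type*} {m m0 : MeasurableSpace Ω}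
    {μ : Measure Ω} [IsProbabilityMeasure μ] (hm : m ≤ m0) {y : Ω → ℝ} (hy : Integrable y μ)
    (hy0 : ∀ ω, 0 ≤ y ω) (hM : M ≠ ∞)
    (h : ∀ s, MeasurableSet[m] s → ∫⁻ ω in s, ‖y ω‖ₑ ∂μ ≤ M * μ s) :
    ∀ᵐ ω ∂μ, (μ[y | m]) ω ≤ M.toReal := by
  refine ae_le_of_ae_le_trim (hm := hm) ?_
  refine ae_le_of_forall_setIntegral_le
    (integrable_condExp.trim hm stronglyMeasurable_condExp) (integrable_const _) fun s hs _ => ?_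
  rw [← setIntegral_trim hm stronglyMeasurable_condExp hs, setIntegral_condExp hm hy hs,
    setIntegral_const, smul_eq_mul, measureReal_def, trim_measurableSet_eq hm hs,
    integral_eq_lintegral_of_nonneg_ae (Eventually.of_forall hy0) hy.1.restrict, mul_comm,
    ← ENNReal.toReal_mul]
  refine ENNReal.toReal_mono (ENNReal.mul_ne_top hM (measure_ne_top _ _)) ?_
  refine le_trans (le_of_eq (lintegral_congr fun ω => ?_)) (h s hs)
  rw [← ofReal_norm, Real.norm_of_nonneg (hy0 ω)]

/-- The exponent 3/4 is a choice in (1/2, 1): above 1/2 the normalised squared weights are summable,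
below 1 the bound can be absorbed by the sum of squares itself. -/
theorem IsNoise.ae_linear_sum_le [IsProbabilityMeasure μ] (hη : IsNoise μ 𝒢 α M η) (hα : 2 ≤ α)
    (hM : M ≠ ∞) {c : ℕ → Ω → ℝ} (hc : ∀ t, StronglyMeasurable[𝒢 t] (c t)) :
    ∀ᵐ ω ∂μ, ∃ C, ∀ T, |∑ t ∈ Finset.range T, c t ω * η t ω| ≤
      C * (1 + ∑ t ∈ Finset.range T, c t ω ^ 2) ^ (3 / 4 : ℝ) := by
  have hSpos : ∀ T ω, 0 < 1 + ∑ t ∈ Finset.range T, c t ω ^ 2 := fun T ω => by positivity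
  have hB : ∀ T ω, ∑ t ∈ Finset.range T,
      (|c t ω| / (1 + ∑ i ∈ Finset.range (t + 1), c i ω ^ 2) ^ (3 / 4 : ℝ)) ^ (2 : ℝ) ≤ 2 := by
    intro T ω
    refine le_trans (le_of_eq (Finset.sum_congr rfl fun t _ => ?_))
      ((sum_div_rpow_le (u := fun t => c t ω ^ 2) (q := 3 / 2) (fun t => sq_nonneg _)
        (by norm_num) T).trans (by norm_num))
    rw [Real.div_rpow (abs_nonneg _) (Real.rpow_nonneg (hSpos _ _).le _), Real.rpow_two, sq_abs,
      ← Real.rpow_mul (hSpos _ _).le]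
    norm_num
  have h := ae_weighted_centered_sums_le (μ := μ) 𝒢 (y := η) (g := c)
    (K := fun T ω => (1 + ∑ t ∈ Finset.range T, c t ω ^ 2) ^ (3 / 4 : ℝ)) hη.adapted hη.integrable
    one_le_two le_rfl (M := 1 + M) (by finiteness)
    (fun t s hs => setLIntegral_rpow_le_of_le zero_le_two hα (hη.moment t s hs)) hc
    (fun t => by
      refine Measurable.stronglyMeasurable ?_
      refine Measurable.pow_const (Measurable.const_add (Finset.measurable_fun_sum _ fun i hi => ?_) 1) _
      exact ((hc i).mono (𝒢.mono (Nat.lt_succ_iff.1 (Finset.mem_range.1 hi)))).measurable.pow_const 2)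
    (fun t ω => Real.rpow_pos_of_pos (hSpos _ _) _)
    (fun ω a b hab => by
      refine Real.rpow_le_rpow (hSpos _ _).le ?_ (by norm_num)
      gcongr) hB
  filter_upwards [h, ae_all_iff.2 hη.condExp_eq_zero] with ω ⟨C, hC⟩ h0
  refine ⟨C, fun T => ?_⟩
  simpa [h0] using hC T

theorem IsNoise.sq_integrable [IsProbabilityMeasure μ] (hη : IsNoise μ 𝒢 α M η) (hα : 2 ≤ α)
    (hM : M ≠ ∞) (t : ℕ) : Integrable (fun ω => η t ω ^ 2) μ := by
  have h := setLIntegral_rpow_le_of_le zero_le_two hα (hη.moment t _ MeasurableSet.univ)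
  have hsm := ((hη.adapted t).mono (𝒢.le _)).pow 2
  refine ⟨hsm.aestronglyMeasurable, ?_⟩
  rw [hasFiniteIntegral_iff_enorm]
  simp only [Measure.restrict_univ, measure_univ, mul_one, ENNReal.rpow_ofNat] at h
  refine lt_of_le_of_lt (le_trans (le_of_eq (lintegral_congr fun ω => ?_)) h) (by finiteness)
  rw [enorm_pow]

/-- Weighted sums of squares of the noise are at most of the order of the sum of the weights. -/
theorem IsNoise.ae_quadratic_sum_le [IsProbabilityMeasure μ] (hη : IsNoise μ 𝒢 α M η) (hα : 2 < α)
    (hα4 : α ≤ 4) (hM : M ≠ ∞) {h : ℕ → Ω → ℝ} (hh : ∀ t, StronglyMeasurable[𝒢 t] (h t))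
    (hh0 : ∀ t ω, 0 ≤ h t ω) (hh1 : ∀ t ω, h t ω ≤ 1) :
    ∀ᵐ ω ∂μ, ∃ C, ∀ T, ∑ t ∈ Finset.range T, h t ω * η t ω ^ 2 ≤
      C * (1 + ∑ t ∈ Finset.range T, h t ω) := by
  have hp : 1 < α / 2 := by linarith
  have hHpos : ∀ T ω, 0 < 1 + ∑ t ∈ Finset.range T, h t ω := fun T ω => by
    have := Finset.sum_nonneg (s := Finset.range T) fun i _ => hh0 i ω
    linarith
  -- Weights in [0, 1] satisfy h^(α/2) ≤ h, so the integral test applies with exponent α/2 > 1. The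
  -- cap α ≤ 4 keeps the moment exponent α/2 of η² at most 2.
  have hB : ∀ T ω, ∑ t ∈ Finset.range T,
      (|h t ω| / (1 + ∑ i ∈ Finset.range (t + 1), h i ω)) ^ (α / 2) ≤ 1 / (α / 2 - 1) := by
    intro T ω
    refine le_trans (Finset.sum_le_sum fun t _ => ?_)
      (sum_div_rpow_le (u := fun t => h t ω) (q := α / 2) (fun t => hh0 t ω) hp T)
    rw [Real.div_rpow (abs_nonneg _) (hHpos _ _).le, abs_of_nonneg (hh0 t ω)]
    refine div_le_div_of_nonneg_right ?_ (Real.rpow_nonneg (hHpos _ _).le _)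
    have := Real.rpow_le_rpow_of_exponent_ge' (hh0 t ω) (hh1 t ω) zero_le_one hp.le
    simpa using this
  have hw := ae_weighted_centered_sums_le (μ := μ) 𝒢 (y := fun t ω => η t ω ^ 2) (g := h)
    (K := fun T ω => 1 + ∑ t ∈ Finset.range T, h t ω) (fun t => (hη.adapted t).pow 2)
    (hη.sq_integrable hα.le hM) hp.le (by linarith) (M := M) hM
    (fun t s hs => by
      refine le_trans (le_of_eq (lintegral_congr fun ω => ?_)) (hη.moment t s hs)
      rw [enorm_pow, ← ENNReal.rpow_natCast, ← ENNReal.rpow_mul]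
      congr 1
      push_cast; ring) hh
    (fun t => by
      refine Measurable.stronglyMeasurable ?_
      refine Measurable.const_add (Finset.measurable_fun_sum _ fun i hi => ?_) 1
      exact ((hh i).mono (𝒢.mono (Nat.lt_succ_iff.1 (Finset.mem_range.1 hi)))).measurable)
    hHpos (fun ω a b hab => by
      have : ∑ t ∈ Finset.range a, h t ω ≤ ∑ t ∈ Finset.range b, h t ω :=
        Finset.sum_le_sum_of_subset_of_nonneg (Finset.range_mono hab) fun i _ _ => hh0 i ω
      simpa using this) hB
  have hce : ∀ t, ∀ᵐ ω ∂μ, (μ[fun ω => η t ω ^ 2 | 𝒢 t]) ω ≤ (1 + M).toReal := fun t => by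
    refine ae_condExp_le_of_forall_setLIntegral_le (𝒢.le t) (hη.sq_integrable hα.le hM t)
      (fun ω => sq_nonneg _) (by finiteness) fun s hs => ?_
    refine le_trans (le_of_eq (lintegral_congr fun ω => ?_))
      (setLIntegral_rpow_le_of_le zero_le_two hα.le (hη.moment t s hs))
    rw [enorm_pow, ENNReal.rpow_ofNat]
  filter_upwards [hw, ae_all_iff.2 hce] with ω ⟨C, hC⟩ h2
  refine ⟨C + (1 + M).toReal, fun T => ?_⟩
  have h3 := (abs_le.1 (hC T)).2
  simp only [mul_sub, Finset.sum_sub_distrib] at h3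
  have h4 : ∑ t ∈ Finset.range T, h t ω * (μ[fun ω => η t ω ^ 2 | 𝒢 t]) ω ≤
      (1 + M).toReal * ∑ t ∈ Finset.range T, h t ω := by
    rw [Finset.mul_sum]
    refine Finset.sum_le_sum fun t _ => ?_
    rw [mul_comm]
    exact mul_le_mul_of_nonneg_right (h2 t) (hh0 t ω)
  have h5 : 0 ≤ (1 + M).toReal := ENNReal.toReal_nonneg
  linarith

/-- Compare C with S^(1/4). This is Young's inequality with unit coefficient on S, needed for an
exact cancellation against the negative sum in `selfNorm_eq`. -/
theorem rpow_three_quarters_le {C S : ℝ} (hC : 0 ≤ C) (hS : 0 ≤ S) :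
    C * S ^ (3 / 4 : ℝ) ≤ C ^ 4 + S := by
  rcases le_total C (S ^ (1 / 4 : ℝ)) with h | h
  · have h1 : S ^ (1 / 4 : ℝ) * S ^ (3 / 4 : ℝ) = S := by
      rw [← Real.rpow_add' hS (by norm_num)]; norm_num
    have := mul_le_mul_of_nonneg_right h (Real.rpow_nonneg hS (3 / 4))
    nlinarith [pow_nonneg hC 4]
  · have h1 : S ^ (3 / 4 : ℝ) = (S ^ (1 / 4 : ℝ)) ^ 3 := by
      rw [← Real.rpow_natCast, ← Real.rpow_mul hS]; norm_num
    have h2 : (S ^ (1 / 4 : ℝ)) ^ 3 ≤ C ^ 3 := pow_le_pow_left₀ (Real.rpow_nonneg hS _) h 3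
    rw [h1]
    nlinarith [mul_le_mul_of_nonneg_left h2 hC]

theorem measurable_det {m : MeasurableSpace Ω} {n : ℕ} {A : Ω → Matrix (Fin n) (Fin n) ℝ}
    (hA : ∀ i j, Measurable[m] fun ω => A ω i j) : Measurable[m] fun ω => (A ω).det := by
  simp only [Matrix.det_apply]
  exact Finset.measurable_fun_sum _ fun σ _ =>
    (Finset.measurable_fun_prod _ fun i _ => hA (σ i) i).const_smul _

/-- Cramer's rule: each entry of the inverse is a quotient of determinants in measurable entries. -/
theorem measurable_gram_inv_apply {m : MeasurableSpace Ω} {n : ℕ} {z : ℕ → Ω → Fin n → ℝ} {T : ℕ}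
    (hz : ∀ t < T, ∀ j, Measurable[m] fun ω => z t ω j) (i j : Fin n) :
    Measurable[m] fun ω => (gram (fun t => z t ω) T)⁻¹ i j := by
  have hG : ∀ a b, Measurable[m] fun ω => gram (fun t => z t ω) T a b := fun a b => by
    simp only [gram, Matrix.add_apply, Matrix.sum_apply, Matrix.vecMulVec_apply]
    exact (Finset.measurable_fun_sum _ fun t ht => (hz t (Finset.mem_range.1 ht) a).mul
      (hz t (Finset.mem_range.1 ht) b)).const_add _
  simp only [Matrix.inv_def, Ring.inverse_eq_inv', Matrix.smul_apply, smul_eq_mul,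
    Matrix.adjugate_apply]
  refine (measurable_det hG).inv.mul (measurable_det fun a b => ?_)
  simp only [Matrix.updateRow_apply]
  split_ifs
  · exact measurable_const
  · exact hG a b

/-- The self-normalised noise correlation is at most of the order of the logarithm of the
determinant of the Gram matrix. -/
theorem IsNoise.ae_selfNorm_le [IsProbabilityMeasure μ] (hη : IsNoise μ 𝒢 α M η) (hα : 2 < α)
    (hα4 : α ≤ 4) (hM : M ≠ ∞) {n : ℕ} {z : ℕ → Ω → Fin n → ℝ}
    (hz : ∀ t j, Measurable[𝒢 t] fun ω => z t ω j) :
    ∀ᵐ ω ∂μ, ∃ C, 0 ≤ C ∧ ∀ T, selfNorm (fun t => z t ω) (fun t => η t ω) T ≤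
      C * (1 + Real.log (gram (fun t => z t ω) T).det) := by
  have hzT : ∀ T, ∀ t < T, ∀ j, Measurable[𝒢 T] fun ω => z t ω j := fun T t ht j =>
    (hz t j).mono (𝒢.mono ht.le) le_rfl
  set l : ℕ → Ω → ℝ := fun t ω => leverage (fun t => z t ω) t with hl
  set b : ℕ → Ω → ℝ := fun t ω => prediction (fun t => z t ω) (fun t => η t ω) t with hb
  have hlm : ∀ t, Measurable[𝒢 t] (l t) := fun t => by
    simp only [hl, leverage, dotProduct, Matrix.mulVec]
    exact Finset.measurable_fun_sum _ fun i _ => (hz t i).mul (Finset.measurable_fun_sum _ fun j _ =>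
      (measurable_gram_inv_apply (hzT t) i j).mul (hz t j))
  have hcm : ∀ t j, Measurable[𝒢 t] fun ω => corr (fun t => z t ω) (fun t => η t ω) t j :=
    fun t j => by
      simp only [corr, Finset.sum_apply, Pi.smul_apply, smul_eq_mul]
      refine Finset.measurable_fun_sum _ fun u hu => ?_
      have hu' := Finset.mem_range.1 hu
      exact ((hη.adapted u).mono (𝒢.mono hu')).measurable.mul (hzT t u hu' j)
  have hbm : ∀ t, Measurable[𝒢 t] (b t) := fun t => by
    simp only [hb, prediction, dotProduct, Matrix.mulVec]
    exact Finset.measurable_fun_sum _ fun i _ => (hz t i).mul (Finset.measurable_fun_sum _ fun j _ =>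
      (measurable_gram_inv_apply (hzT t) i j).mul (hcm t j))
  have hl0 : ∀ t ω, 0 ≤ l t ω := fun t ω => leverage_nonneg _ _
  have hl1 : ∀ t ω, 0 < 1 + l t ω := fun t ω => by linarith [hl0 t ω]
  filter_upwards [hη.ae_linear_sum_le hα.le hM (c := fun t ω => b t ω / (1 + l t ω))
      (fun t => ((hbm t).div ((hlm t).const_add 1)).stronglyMeasurable),
    hη.ae_quadratic_sum_le hα hα4 hM (h := fun t ω => l t ω / (1 + l t ω))
      (fun t => ((hlm t).div ((hlm t).const_add 1)).stronglyMeasurable)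
      (fun t ω => div_nonneg (hl0 t ω) (hl1 t ω).le)
      (fun t ω => (div_le_one (hl1 t ω)).2 (by linarith))] with ω ⟨C₁, h1⟩ ⟨C₂, h2⟩
  refine ⟨1 + 2 * (2 * |C₁|) ^ 4 + |C₂|, by positivity, fun T => ?_⟩
  have hdet := sum_leverage_le_log_det (fun t => z t ω) T
  have hlev0 : 0 ≤ ∑ t ∈ Finset.range T, l t ω / (1 + l t ω) :=
    Finset.sum_nonneg fun t _ => div_nonneg (hl0 t ω) (hl1 t ω).le
  set S := ∑ t ∈ Finset.range T, (b t ω / (1 + l t ω)) ^ 2 with hS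
  have hS0 : 0 ≤ S := Finset.sum_nonneg fun t _ => sq_nonneg _
  -- The linear term is at most (2|C₁|)⁴ + 1 + S, and this inequality lets the negative sum remove
  -- S.
  have h3 : S ≤ ∑ t ∈ Finset.range T, b t ω ^ 2 / (1 + l t ω) := by
    refine Finset.sum_le_sum fun t _ => ?_
    rw [div_pow]
    refine div_le_div_of_nonneg_left (sq_nonneg _) (hl1 t ω) ?_
    nlinarith [hl0 t ω]
  have h4 := (le_abs_self _).trans (h1 T)
  have h5 : C₁ * (1 + S) ^ (3 / 4 : ℝ) ≤ |C₁| * (1 + S) ^ (3 / 4 : ℝ) :=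
    mul_le_mul_of_nonneg_right (le_abs_self _) (Real.rpow_nonneg (by linarith) _)
  have h6 := rpow_three_quarters_le (C := 2 * |C₁|) (S := 1 + S) (by positivity) (by linarith)
  have h7 := h2 T
  have h8 : C₂ * (1 + ∑ t ∈ Finset.range T, l t ω / (1 + l t ω)) ≤
      |C₂| * (1 + Real.log (gram (fun t => z t ω) T).det) :=
    mul_le_mul (le_abs_self _) (by linarith) (by linarith) (abs_nonneg _)
  rw [selfNorm_eq]
  have h9 : 0 ≤ Real.log (gram (fun t => z t ω) T).det := hlev0.trans hdet
  have h10 : 0 ≤ (1 + 2 * (2 * |C₁|) ^ 4) * Real.log (gram (fun t => z t ω) T).det := by positivity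
  have h11 : 0 ≤ (2 * |C₁|) ^ 4 := by positivity
  change 2 * ∑ t ∈ Finset.range T, b t ω / (1 + l t ω) * η t ω
      + ∑ t ∈ Finset.range T, l t ω / (1 + l t ω) * η t ω ^ 2
      - ∑ t ∈ Finset.range T, b t ω ^ 2 / (1 + l t ω) ≤ _
  nlinarith

end Noise

/-! ### Conditioning additionally on an independent mode. -/

section Enlargement

variable {Ω : Type*} {k : ℕ}

/-- A set of the σ-algebra generated by `F` and a variable `s` coincides with a set of `F` on each
level set of `s`. -/
theorem exists_measurableSet_inter_eq {Ω : Type*} {F : MeasurableSpace Ω} {k : ℕ} {s : Ω → Fin k}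
    {E : Set Ω} (hE : MeasurableSet[F ⊔ MeasurableSpace.comap s inferInstance] E) (j : Fin k) :
    ∃ A, MeasurableSet[F] A ∧ E ∩ {ω | s ω = j} = A ∩ {ω | s ω = j} := by
  -- The sets with the required trace on the fibre form a σ-algebra, and it contains both
  -- generators.
  let m' : MeasurableSpace Ω :=
    { MeasurableSet' := fun E => ∃ A, MeasurableSet[F] A ∧ E ∩ {ω | s ω = j} = A ∩ {ω | s ω = j}
      measurableSet_empty := ⟨∅, MeasurableSet.empty, rfl⟩
      measurableSet_compl := fun E ⟨A, hA, h⟩ => ⟨Aᶜ, hA.compl, by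
        ext ω
        have := Set.ext_iff.1 h ω
        simp only [Set.mem_inter_iff, Set.mem_compl_iff] at this ⊢
        tauto⟩
      measurableSet_iUnion := fun f hf => by
        choose A hA h using hf
        refine ⟨⋃ i, A i, MeasurableSet.iUnion hA, ?_⟩
        rw [Set.iUnion_inter, Set.iUnion_inter]
        exact Set.iUnion_congr h }
  have hle : F ⊔ MeasurableSpace.comap s inferInstance ≤ m' := by
    refine sup_le (fun A hA => ⟨A, hA, rfl⟩) ?_
    rintro _ ⟨B, _, rfl⟩
    by_cases hj : j ∈ B
    · refine ⟨Set.univ, @MeasurableSet.univ _ F, ?_⟩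
      ext ω
      simp only [Set.mem_inter_iff, Set.mem_preimage, Set.mem_ofPred_eq, Set.mem_univ, true_and,
        and_iff_right_iff_imp]
      intro h; exact h ▸ hj
    · refine ⟨∅, @MeasurableSet.empty _ F, ?_⟩
      ext ω
      simp only [Set.mem_inter_iff, Set.mem_preimage, Set.mem_ofPred_eq, Set.mem_empty_iff_false,
        false_and, iff_false, not_and]
      intro h h'; exact hj (h' ▸ h)
  exact hle _ hE

theorem iUnion_inter_fiber (s : Ω → Fin k) (E : Set Ω) : ⋃ j, E ∩ {ω | s ω = j} = E := by
  ext ω; simp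

theorem pairwise_disjoint_inter_fiber (s : Ω → Fin k) (E : Set Ω) :
    Pairwise (Function.onFun Disjoint fun j => E ∩ {ω | s ω = j}) := fun i j hij => by
  refine Set.disjoint_left.2 fun ω h1 h2 => hij ?_
  exact h1.2.symm.trans h2.2

variable {F H m0 : MeasurableSpace Ω} {μ : Measure Ω} {s : Ω → Fin k}

theorem measurableSet_fiber {s : Ω → Fin k} (j : Fin k) :
    MeasurableSet[MeasurableSpace.comap s inferInstance] {ω | s ω = j} :=
  ⟨{j}, MeasurableSet.singleton j, rfl⟩

theorem setLIntegral_inter_of_indep (hH : H ≤ m0) (hs : Measurable s)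
    (hind : Indep (MeasurableSpace.comap s inferInstance) H μ) {f : Ω → ℝ≥0∞}
    (hf : Measurable[H] f) {A : Set Ω} (hA : MeasurableSet[H] A) (j : Fin k) :
    ∫⁻ ω in A ∩ {ω | s ω = j}, f ω ∂μ = μ {ω | s ω = j} * ∫⁻ ω in A, f ω ∂μ := by
  have hj : MeasurableSet[MeasurableSpace.comap s inferInstance] {ω | s ω = j} :=
    measurableSet_fiber j
  have hj0 := hs.comap_le _ hj
  have h := lintegral_mul_eq_lintegral_mul_lintegral_of_independent_measurableSpace
    hs.comap_le hH hind (f := {ω | s ω = j}.indicator fun _ => 1) (g := A.indicator f)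
    (Measurable.indicator (measurable_const (a := (1 : ℝ≥0∞))) hj)
    (hf.indicator hA)
  rw [lintegral_indicator_const hj0, one_mul, lintegral_indicator (hH _ hA)] at h
  rw [← h, ← lintegral_indicator ((hH _ hA).inter hj0)]
  refine lintegral_congr fun ω => ?_
  by_cases h1 : s ω = j <;> by_cases h2 : ω ∈ A <;> simp [h1, h2]

theorem setIntegral_inter_of_indep (hH : H ≤ m0) (hs : Measurable s)
    (hind : Indep (MeasurableSpace.comap s inferInstance) H μ) {f : Ω → ℝ}
    (hf : StronglyMeasurable[H] f) {A : Set Ω} (hA : MeasurableSet[H] A) (j : Fin k) :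
    ∫ ω in A ∩ {ω | s ω = j}, f ω ∂μ = μ.real {ω | s ω = j} * ∫ ω in A, f ω ∂μ := by
  have hj : MeasurableSet[MeasurableSpace.comap s inferInstance] {ω | s ω = j} :=
    measurableSet_fiber j
  have hj0 := hs.comap_le _ hj
  have hX : Measurable[MeasurableSpace.comap s inferInstance] ({ω | s ω = j}.indicator (1 : Ω → ℝ)) :=
    Measurable.indicator (measurable_const (a := (1 : ℝ))) hj
  have hY : Measurable[H] (A.indicator f) := hf.measurable.indicator hA
  have hXY : IndepFun ({ω | s ω = j}.indicator (1 : Ω → ℝ)) (A.indicator f) μ := by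
    rw [IndepFun_iff_Indep]
    exact indep_of_indep_of_le_right (indep_of_indep_of_le_left hind hX.comap_le) hY.comap_le
  have h := hXY.integral_fun_mul_eq_mul_integral
    (hX.mono hs.comap_le le_rfl).aestronglyMeasurable (hY.mono hH le_rfl).aestronglyMeasurable
  rw [integral_indicator_one hj0, integral_indicator (hH _ hA)] at h
  rw [← h, ← integral_indicator ((hH _ hA).inter hj0)]
  refine integral_congr_ae (Eventually.of_forall fun ω => ?_)
  by_cases h1 : s ω = j <;> by_cases h2 : ω ∈ A <;> simp [h1, h2]

/-- Conditional moment bounds survive the enlargement of the conditioning by an independent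
variable. -/
theorem setLIntegral_le_of_enlargement (hH : H ≤ m0) (hFH : F ≤ H) (hs : Measurable s)
    (hind : Indep (MeasurableSpace.comap s inferInstance) H μ) {f : Ω → ℝ≥0∞}
    (hf : Measurable[H] f) {M : ℝ≥0∞}
    (h : ∀ A, MeasurableSet[F] A → ∫⁻ ω in A, f ω ∂μ ≤ M * μ A) {E : Set Ω}
    (hE : MeasurableSet[F ⊔ MeasurableSpace.comap s inferInstance] E) :
    ∫⁻ ω in E, f ω ∂μ ≤ M * μ E := by
  have hE0 : MeasurableSet E := (sup_le (hFH.trans hH) hs.comap_le) _ hE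
  have hm : ∀ j, MeasurableSet (E ∩ {ω | s ω = j}) := fun j =>
    hE0.inter (hs.comap_le _ (measurableSet_fiber j))
  conv_lhs => rw [← iUnion_inter_fiber s E]
  conv_rhs => rw [← iUnion_inter_fiber s E]
  rw [lintegral_iUnion hm (pairwise_disjoint_inter_fiber s E),
    measure_iUnion (pairwise_disjoint_inter_fiber s E) hm, ← ENNReal.tsum_mul_left]
  refine ENNReal.tsum_le_tsum fun j => ?_
  -- On the fibre s = j the set E is an F-set, and independence of s from H factors μ{s = j} out of
  -- both sides. F-independence alone would not do, since f is only H-measurable.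
  obtain ⟨A, hA, hAj⟩ := exists_measurableSet_inter_eq hE j
  have h1 : μ (A ∩ {ω | s ω = j}) = μ {ω | s ω = j} * μ A := by
    have := setLIntegral_inter_of_indep hH hs hind
      (measurable_const (a := (1 : ℝ≥0∞))) (hFH _ hA) j
    simpa using this
  rw [hAj, setLIntegral_inter_of_indep hH hs hind hf (hFH _ hA) j, h1, mul_left_comm]
  exact mul_le_mul_right (h A hA) _

/-- A centred variable stays centred after the enlargement of the conditioning by an independent
variable. -/
theorem condExp_eq_zero_of_enlargement [IsProbabilityMeasure μ] (hH : H ≤ m0) (hFH : F ≤ H)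
    (hs : Measurable s) (hind : Indep (MeasurableSpace.comap s inferInstance) H μ) {f : Ω → ℝ}
    (hf : StronglyMeasurable[H] f) (hint : Integrable f μ) (h : μ[f | F] =ᵐ[μ] 0) :
    μ[f | F ⊔ MeasurableSpace.comap s inferInstance] =ᵐ[μ] 0 := by
  have hle : F ⊔ MeasurableSpace.comap s inferInstance ≤ m0 :=
    sup_le (hFH.trans hH) hs.comap_le
  refine (ae_eq_condExp_of_forall_setIntegral_eq hle hint
    (fun _ _ _ => integrable_zero _ _ _) (fun E hE _ => ?_)
    stronglyMeasurable_zero.aestronglyMeasurable).symm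
  have hm : ∀ j, MeasurableSet (E ∩ {ω | s ω = j}) := fun j =>
    (hle _ hE).inter (hs.comap_le _ (measurableSet_fiber j))
  have hterm : ∀ j, ∫ ω in E ∩ {ω | s ω = j}, f ω ∂μ = 0 := fun j => by
    obtain ⟨A, hA, hAj⟩ := exists_measurableSet_inter_eq hE j
    have h0 : ∫ ω in A, f ω ∂μ = 0 := by
      rw [← setIntegral_condExp (hFH.trans hH) hint hA, integral_congr_ae (ae_restrict_of_ae h)]
      simp
    rw [hAj, setIntegral_inter_of_indep hH hs hind hf (hFH _ hA) j, h0, mul_zero]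
  rw [← iUnion_inter_fiber s E,
    integral_iUnion (f := f) hm (pairwise_disjoint_inter_fiber s E) hint.integrableOn]
  simp [hterm]

end Enlargement

/-! ### Measurability with respect to the histories. -/

section Histories

variable {Ω : Type*} {n k : ℕ} {x : ℕ → Ω → EuclideanSpace ℝ (Fin n)} {s : ℕ → Ω → Fin k}

theorem measurable_state_history {u t : ℕ} (h : u ≤ t) : Measurable[history x s t] (x u) :=
  (comap_measurable (x u)).mono (le_sup_of_le_left (le_iSup₂_of_le u h le_rfl)) le_rfl

theorem measurable_mode_history {u t : ℕ} (h : u ≤ t) : Measurable[history x s t] (s u) :=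
  (comap_measurable (s u)).mono (le_sup_of_le_right (le_iSup₂_of_le u h le_rfl)) le_rfl

theorem measurable_state_before {u t : ℕ} (h : u ≤ t) :
    Measurable[historyBeforeSwitch x s t] (x u) :=
  (comap_measurable (x u)).mono (le_sup_of_le_left (le_iSup₂_of_le u h le_rfl)) le_rfl

theorem measurable_mode_before {u t : ℕ} (h : u < t) :
    Measurable[historyBeforeSwitch x s t] (s u) :=
  (comap_measurable (s u)).mono (le_sup_of_le_right (le_iSup₂_of_le u h le_rfl)) le_rfl

theorem history_le_of_measurable {m : MeasurableSpace Ω} {t : ℕ}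
    (hx : ∀ u ≤ t, Measurable[m] (x u)) (hs : ∀ u ≤ t, Measurable[m] (s u)) :
    history x s t ≤ m :=
  sup_le (iSup₂_le fun u hu => (hx u hu).comap_le) (iSup₂_le fun u hu => (hs u hu).comap_le)

theorem historyBeforeSwitch_le_of_measurable {m : MeasurableSpace Ω} {t : ℕ}
    (hx : ∀ u ≤ t, Measurable[m] (x u)) (hs : ∀ u < t, Measurable[m] (s u)) :
    historyBeforeSwitch x s t ≤ m :=
  sup_le (iSup₂_le fun u hu => (hx u hu).comap_le) (iSup₂_le fun u hu => (hs u hu).comap_le)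

theorem history_le_before_succ (t : ℕ) : history x s t ≤ historyBeforeSwitch x s (t + 1) :=
  history_le_of_measurable (fun _ hu => measurable_state_before (hu.trans t.le_succ))
    fun _ hu => measurable_mode_before (Nat.lt_succ_of_le hu)

theorem before_le_history (t : ℕ) : historyBeforeSwitch x s t ≤ history x s t :=
  historyBeforeSwitch_le_of_measurable (fun _ hu => measurable_state_history hu)
    fun _ hu => measurable_mode_history hu.le

theorem history_mono : Monotone (history x s) := fun _ _ h =>
  history_le_of_measurable (fun _ hu => measurable_state_history (hu.trans h))
    fun _ hu => measurable_mode_history (hu.trans h)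

theorem before_mono : Monotone (historyBeforeSwitch x s) := fun _ _ h =>
  historyBeforeSwitch_le_of_measurable (fun _ hu => measurable_state_before (hu.trans h))
    fun _ hu => measurable_mode_before (hu.trans_le h)

theorem measurable_act_mode {A : Fin k → Matrix (Fin n) (Fin n) ℝ} {m : MeasurableSpace Ω}
    {σ : Ω → Fin k} {y : Ω → EuclideanSpace ℝ (Fin n)} (hσ : Measurable σ) (hy : Measurable y) :
    Measurable fun ω => act (A (σ ω)) (y ω) := by
  have h : Measurable fun q : Fin k × EuclideanSpace ℝ (Fin n) => act (A q.1) q.2 := by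
    refine measurable_from_prod_countable_right fun i => ?_
    exact (act (A i)).continuous.measurable
  have h1 := h.comp (hσ.prodMk hy)
  have e : (fun ω => act (A (σ ω)) (y ω)) =
      (fun q : Fin k × EuclideanSpace ℝ (Fin n) => act (A q.1) q.2) ∘ fun ω => (σ ω, y ω) := by
    ext1 ω; simp only [Function.comp_apply]
  rw [e]; exact h1

end Histories

/-! ### Filtrations of the system and localisation of the noise. -/

section System

variable {Ω : Type*} [mΩ : MeasurableSpace Ω] {μ : Measure Ω} {n k : ℕ}
  {A : Fin k → Matrix (Fin n) (Fin n) ℝ} {p : Fin k → ℝ} {x₀ : EuclideanSpace ℝ (Fin n)}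
  {s : ℕ → Ω → Fin k} {x w : ℕ → Ω → EuclideanSpace ℝ (Fin n)}

namespace IsSwitchedLinearSystem

theorem measurable_state (hsys : IsSwitchedLinearSystem μ A p x₀ s x w) (t : ℕ) :
    Measurable (x t) := by
  induction t with
  | zero => rw [funext hsys.initial]; exact measurable_const
  | succ t ih =>
    rw [funext (hsys.dynamics t)]
    exact (measurable_act_mode (hsys.measurable_mode t) ih).add (hsys.measurable_noise t)

theorem history_le (hsys : IsSwitchedLinearSystem μ A p x₀ s x w) (t : ℕ) : history x s t ≤ mΩ :=
  history_le_of_measurable (fun u _ => hsys.measurable_state u) fun u _ => hsys.measurable_mode u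

theorem before_le (hsys : IsSwitchedLinearSystem μ A p x₀ s x w) (t : ℕ) :
    historyBeforeSwitch x s t ≤ mΩ :=
  (before_le_history t).trans (hsys.history_le t)

/-- The noise is recovered from two consecutive states and the current mode. Hence it is independent
of the next mode, by `mode_indep_past`. -/
theorem measurable_noise_before (hsys : IsSwitchedLinearSystem μ A p x₀ s x w) (t : ℕ) :
    Measurable[historyBeforeSwitch x s (t + 1)] (w t) := by
  have h : w t = fun ω => x (t + 1) ω - act (A (s t ω)) (x t ω) := by
    ext1 ω; rw [hsys.dynamics]; abel
  rw [h]
  exact (measurable_state_before le_rfl).sub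
    (measurable_act_mode (measurable_mode_before t.lt_succ_self) (measurable_state_before t.le_succ))

/-- The information available after the state `x_t` and the modes up to `s_{t+1}` are known. -/
def enlargedHistory (hsys : IsSwitchedLinearSystem μ A p x₀ s x w) : Filtration ℕ mΩ where
  seq t := history x s t ⊔ MeasurableSpace.comap (s (t + 1)) inferInstance
  mono' a b h := by
    rcases h.eq_or_lt with rfl | h
    · exact le_rfl
    · exact le_sup_of_le_left (sup_le (history_mono h.le) (measurable_mode_history h).comap_le)
  le' t := sup_le (hsys.history_le t) (hsys.measurable_mode _).comap_le

/-- The information available just before the mode `s_{t+1}` is drawn, as a filtration. -/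
def beforeFiltration (hsys : IsSwitchedLinearSystem μ A p x₀ s x w) : Filtration ℕ mΩ where
  seq t := historyBeforeSwitch x s (t + 1)
  mono' _ _ h := before_mono (Nat.succ_le_succ h)
  le' _ := hsys.before_le _

theorem before_succ_le_enlarged (hsys : IsSwitchedLinearSystem μ A p x₀ s x w) (t : ℕ) :
    historyBeforeSwitch x s (t + 1) ≤ hsys.enlargedHistory (t + 1) :=
  (before_le_history _).trans le_sup_left

end IsSwitchedLinearSystem

/-- A truncation of the noise whose conditional moments are bounded by a constant. -/
structure IsLocalNoise (hsys : IsSwitchedLinearSystem μ A p x₀ s x w) (α : ℝ) (M : ℝ≥0∞)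
    (w' : ℕ → Ω → EuclideanSpace ℝ (Fin n)) : Prop where
  two_lt : 2 < α
  le_four : α ≤ 4
  ne_top : M ≠ ∞
  measurable_before : ∀ t, Measurable[historyBeforeSwitch x s (t + 1)] (w' t)
  moment : ∀ t, ∫⁻ ω, ‖w' t ω‖ₑ ^ α ∂μ ≤ M
  isNoise : ∀ j, IsNoise μ hsys.enlargedHistory α M fun t ω => w' t ω j

theorem enorm_coord_le (v : EuclideanSpace ℝ (Fin n)) (j : Fin n) : ‖v j‖ₑ ≤ ‖v‖ₑ := by
  rw [← ofReal_norm, ← ofReal_norm]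
  exact ENNReal.ofReal_le_ofReal (PiLp.norm_apply_le v j)

/-- Up to null sets, the noise is one of countably many sequences with bounded conditional
moments. -/
theorem exists_localNoise [IsProbabilityMeasure μ]
    (hsys : IsSwitchedLinearSystem μ A p x₀ s x w) (hnoise : NoiseAssumption μ s x w) :
    ∃ (α : ℝ) (w' : ℕ → ℕ → Ω → EuclideanSpace ℝ (Fin n)),
      (∀ m : ℕ, IsLocalNoise hsys α (1 + m) (w' m)) ∧ ∀ᵐ ω ∂μ, ∃ m, ∀ t, w' m t ω = w t ω := by
  obtain ⟨α₀, hα₀, hmom⟩ := hnoise.moment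
  set f : ℕ → Ω → ℝ≥0∞ := fun t => μ⁻[fun ω' => ‖w t ω'‖ₑ ^ α₀ | history x s t] with hf
  have hset : ∀ (m t : ℕ), MeasurableSet[history x s t] {ω | f t ω ≤ m} := fun m t =>
    measurable_condLExp (history x s t) μ _ measurableSet_Iic
  -- The truncating event lies in the history at t, so the truncated noise keeps conditional mean
  -- zero. Capping the exponent at 4 keeps half of it in (1, 2]; lowering the exponent costs the 1
  -- in the bound 1 + m.
  refine ⟨min α₀ 4, fun m t => {ω | f t ω ≤ m}.indicator (w t), fun m => ?_, ?_⟩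
  · have hbef : ∀ t, Measurable[historyBeforeSwitch x s (t + 1)] ({ω | f t ω ≤ m}.indicator (w t)) :=
      fun t => (hsys.measurable_noise_before t).indicator (history_le_before_succ t _ (hset m t))
    have hint : ∀ t, Integrable ({ω | f t ω ≤ m}.indicator (w t)) μ := fun t =>
      (hnoise.integrable t).indicator (hsys.history_le t _ (hset m t))
    have hmomF : ∀ t B, MeasurableSet[history x s t] B →
        ∫⁻ ω in B, ‖({ω | f t ω ≤ m}.indicator (w t)) ω‖ₑ ^ (min α₀ 4) ∂μ ≤ (1 + m) * μ B := by
      intro t B hB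
      refine setLIntegral_rpow_le_of_le (by positivity) (min_le_left _ _) (b := α₀) ?_
      have h1 : ∀ ω, ‖({ω | f t ω ≤ m}.indicator (w t)) ω‖ₑ ^ α₀ =
          {ω | f t ω ≤ m}.indicator (fun ω => ‖w t ω‖ₑ ^ α₀) ω := fun ω => by
        by_cases h : f t ω ≤ m
        · simp [h]
        · simp [h, show 0 < α₀ by linarith]
      have hS := hsys.history_le t _ (hset m t)
      have hB0 := hsys.history_le t _ hB
      simp_rw [h1]
      rw [lintegral_indicator hS, Measure.restrict_restrict hS,
        ← setLIntegral_condLExp (hsys.history_le t) μ _ ((hset m t).inter hB)]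
      calc ∫⁻ ω in {ω | f t ω ≤ m} ∩ B, f t ω ∂μ ≤ ∫⁻ _ in {ω | f t ω ≤ m} ∩ B, (m : ℝ≥0∞) ∂μ :=
            setLIntegral_mono measurable_const fun ω hω => hω.1
        _ = m * μ ({ω | f t ω ≤ m} ∩ B) := by simp
        _ ≤ m * μ B := by gcongr; exact Set.inter_subset_right
    refine ⟨lt_min hα₀ (by norm_num), min_le_right _ _, by finiteness, hbef, fun t => ?_,
      fun j => ⟨fun t => ?_, fun t => ?_, fun t => ?_, fun t B hB => ?_⟩⟩
    · simpa using hmomF t _ MeasurableSet.univ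
    · exact (((EuclideanSpace.proj (𝕜 := ℝ) j).continuous.measurable.comp (hbef t)).mono
        (hsys.before_succ_le_enlarged t) le_rfl).stronglyMeasurable
    · exact (EuclideanSpace.proj (𝕜 := ℝ) j).integrable_comp (hint t)
    · refine condExp_eq_zero_of_enlargement (H := historyBeforeSwitch x s (t + 1))
        (hsys.before_le _) (history_le_before_succ t) (hsys.measurable_mode _)
        (hsys.mode_indep_past _)
        ((EuclideanSpace.proj (𝕜 := ℝ) j).continuous.measurable.comp (hbef t)).stronglyMeasurable
        ((EuclideanSpace.proj (𝕜 := ℝ) j).integrable_comp (hint t)) ?_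
      have h1 := (EuclideanSpace.proj (𝕜 := ℝ) j).comp_condExp_comm (hint t) (m := history x s t)
      have h2 := condExp_indicator (hnoise.integrable t) (hset m t)
      filter_upwards [h1, h2, hnoise.martingale_difference t] with ω h1 h2 h3
      refine h1.symm.trans ?_
      simp only [Function.comp_apply, h2]
      by_cases h : f t ω ≤ m
      · simp [h, h3]
      · simp [h]
    · refine setLIntegral_le_of_enlargement (H := historyBeforeSwitch x s (t + 1))
        (hsys.before_le _) (history_le_before_succ t) (hsys.measurable_mode _)
        (hsys.mode_indep_past _) ?_ (fun B hB => ?_) hB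
      · have hc : Measurable fun v : EuclideanSpace ℝ (Fin n) => ‖v j‖ₑ ^ min α₀ 4 :=
          (EuclideanSpace.proj (𝕜 := ℝ) j).continuous.measurable.enorm.pow_const _
        exact hc.comp (hbef t)
      · refine (lintegral_mono fun ω => ?_).trans (hmomF t B hB)
        exact ENNReal.rpow_le_rpow (enorm_coord_le _ j) (by positivity)
  · filter_upwards [hmom] with ω hω
    obtain ⟨m, hm⟩ := ENNReal.exists_nat_gt hω.ne
    refine ⟨m, fun t => Set.indicator_of_mem ?_ _⟩
    exact (le_iSup (fun t => f t ω) t).trans hm.le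

end System

/-! ### From a geometric mean below one to a contracting power mean. -/

section Contraction

/-- At θ = 0 the power sum is 1 and, for positive σ, its derivative is the logarithm of the weighted
product, hence negative. The bound θ ≤ 1 is kept for the subadditivity of the θ-th power. -/
theorem exists_rpow_mean_lt_one {k : ℕ} {σ p : Fin k → ℝ} (hσ : ∀ i, 0 ≤ σ i) (hp : ∀ i, 0 < p i)
    (hsum : ∑ i, p i = 1) (h : ∏ i, σ i ^ p i < 1) :
    ∃ θ : ℝ, 0 < θ ∧ θ ≤ 1 ∧ ∑ i, p i * σ i ^ θ < 1 := by
  -- Some σ i may vanish; a small shift makes the logarithms meaningful and preserves the strict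
  -- inequality.
  obtain ⟨ε, hε, hprod⟩ : ∃ ε : ℝ, 0 < ε ∧ ∏ i, (σ i + ε) ^ p i < 1 := by
    have hc : Continuous fun ε : ℝ => ∏ i, (σ i + ε) ^ p i :=
      continuous_finsetProd _ fun i _ =>
        (continuous_const.add continuous_id).rpow_const fun _ => Or.inr (hp i).le
    have h0 : ∀ᶠ ε in 𝓝[>] (0 : ℝ), ∏ i, (σ i + ε) ^ p i < 1 :=
      (hc.tendsto 0).mono_left nhdsWithin_le_nhds |>.eventually_lt_const (by simpa using h)
    obtain ⟨ε, h1, h2⟩ := (h0.and self_mem_nhdsWithin).exists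
    exact ⟨ε, h2, h1⟩
  have hpos : ∀ i, 0 < σ i + ε := fun i => by linarith [hσ i]
  have hlog : ∑ i, p i * Real.log (σ i + ε) < 0 := by
    have h1 : ∑ i, p i * Real.log (σ i + ε) = Real.log (∏ i, (σ i + ε) ^ p i) := by
      rw [Real.log_prod fun i _ => (Real.rpow_pos_of_pos (hpos i) _).ne']
      exact Finset.sum_congr rfl fun i _ => (Real.log_rpow (hpos i) _).symm
    rw [h1]
    exact Real.log_neg (Finset.prod_pos fun i _ => Real.rpow_pos_of_pos (hpos i) _) hprod
  have hder : HasDerivAt (fun θ : ℝ => ∑ i, p i * (σ i + ε) ^ θ)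
      (∑ i, p i * Real.log (σ i + ε)) 0 := by
    refine HasDerivAt.fun_sum fun i _ => ?_
    have := ((Real.hasStrictDerivAt_const_rpow (hpos i) 0).hasDerivAt).const_mul (p i)
    simpa using this
  have hslope := hder.tendsto_slope_zero_right.eventually_lt_const hlog
  have hlt1 : ∀ᶠ θ in 𝓝[>] (0 : ℝ), θ < 1 :=
    nhdsWithin_le_nhds (eventually_lt_nhds one_pos)
  obtain ⟨θ, ⟨h1, h2⟩, h3⟩ := ((hslope.and hlt1).and self_mem_nhdsWithin).exists
  have h3' : 0 < θ := h3
  refine ⟨θ, h3', h2.le, ?_⟩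
  have h4 : ∑ i, p i * (σ i + ε) ^ θ < 1 := by
    simp only [zero_add, Real.rpow_zero, mul_one, hsum, smul_eq_mul] at h1
    have := (mul_neg_iff.1 h1)
    rcases this with h | h
    · linarith [h.2]
    · linarith [inv_pos.2 h3', h.1]
  refine lt_of_le_of_lt (Finset.sum_le_sum fun i _ => ?_) h4
  exact mul_le_mul_of_nonneg_left (Real.rpow_le_rpow (hσ i) (by linarith) h3'.le) (hp i).le

/-- The solution of `y_0 = 1`, `y_{t+1} = r_t y_t + 1`. -/
def affineRec (r : ℕ → ℝ) : ℕ → ℝ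
  | 0 => 1
  | t + 1 => r t * affineRec r t + 1

theorem affineRec_pos {r : ℕ → ℝ} (hr : ∀ t, 0 ≤ r t) (t : ℕ) : 0 < affineRec r t := by
  induction t with
  | zero => exact one_pos
  | succ t ih => have := mul_nonneg (hr t) ih.le; rw [affineRec]; linarith

end Contraction

/-! ### Polynomial growth of the state. -/

section Growth

theorem ae_exists_bound_term {Ω : Type*} {m0 : MeasurableSpace Ω} {μ : Measure Ω} {a : ℕ → Ω → ℝ}
    (ha : ∀ t, AEStronglyMeasurable (a t) μ) (h : ∑' t, ∫⁻ ω, ‖a t ω‖ₑ ∂μ ≠ ∞) :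
    ∀ᵐ ω ∂μ, ∃ C, ∀ t, |a t ω| ≤ C := by
  filter_upwards [ae_exists_bound_of_tsum_lintegral (a := fun t ω => |a t ω|)
    (fun t => (ha t).norm) (by simpa using h)] with ω ⟨C, hC⟩
  refine ⟨C, fun t => ?_⟩
  refine le_trans ?_ ((le_abs_self _).trans (hC (t + 1)))
  exact Finset.single_le_sum (f := fun t => |a t ω|) (fun i _ => abs_nonneg _)
    (Finset.self_mem_range_succ t)

/-- A sequence with bounded first moments is a.s. of the order of `t²`. -/
theorem ae_exists_le_mul_sq {Ω : Type*} {m0 : MeasurableSpace Ω} {μ : Measure Ω} {a : ℕ → Ω → ℝ}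
    (ha : ∀ t, AEStronglyMeasurable (a t) μ) {M : ℝ≥0∞} (hM : M ≠ ∞)
    (h : ∀ t, ∫⁻ ω, ‖a t ω‖ₑ ∂μ ≤ M) :
    ∀ᵐ ω ∂μ, ∃ C, ∀ t : ℕ, |a t ω| ≤ C * ((t : ℝ) + 1) ^ 2 := by
  have hs : ∑' t : ℕ, ∫⁻ ω, ‖(((t : ℝ) + 1) ^ 2)⁻¹ * a t ω‖ₑ ∂μ ≠ ∞ := by
    have h1 : ∀ t : ℕ, ∫⁻ ω, ‖(((t : ℝ) + 1) ^ 2)⁻¹ * a t ω‖ₑ ∂μ ≤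
        ENNReal.ofReal ((((t : ℝ) + 1) ^ 2)⁻¹) * M := fun t => by
      simp_rw [enorm_mul]
      rw [lintegral_const_mul'' _ (ha t).enorm, Real.enorm_of_nonneg (by positivity)]
      exact mul_le_mul_right (h t) _
    refine ne_top_of_le_ne_top ?_ (ENNReal.tsum_le_tsum h1)
    rw [ENNReal.tsum_mul_right]
    refine ENNReal.mul_ne_top ?_ hM
    have hsum : Summable fun t : ℕ => (((t : ℝ) + 1) ^ 2)⁻¹ := by
      have := (summable_nat_add_iff 1).2 (Real.summable_nat_pow_inv.2 one_lt_two)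
      simpa using this
    exact hsum.tsum_ofReal_ne_top
  filter_upwards [ae_exists_bound_term (fun t => (ha t).const_mul _) hs] with ω ⟨C, hC⟩
  refine ⟨C, fun t => ?_⟩
  have h2 := hC t
  have hpos : 0 < ((t : ℝ) + 1) ^ 2 := by positivity
  rwa [abs_mul, abs_of_pos (inv_pos.2 hpos), inv_mul_le_iff₀ hpos, mul_comm] at h2

variable {Ω : Type*} [mΩ : MeasurableSpace Ω] {μ : Measure Ω} {n k : ℕ}
  {A : Fin k → Matrix (Fin n) (Fin n) ℝ} {p : Fin k → ℝ} {x₀ : EuclideanSpace ℝ (Fin n)}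
  {s : ℕ → Ω → Fin k} {x w : ℕ → Ω → EuclideanSpace ℝ (Fin n)}

theorem IsSwitchedLinearSystem.prob_pos (hsys : IsSwitchedLinearSystem μ A p x₀ s x w) (i : Fin k) :
    0 < p i :=
  lt_of_le_of_ne (hsys.mode_law 0 i ▸ measureReal_nonneg) (hsys.prob_ne_zero i).symm

theorem IsSwitchedLinearSystem.lintegral_mode [IsProbabilityMeasure μ]
    (hsys : IsSwitchedLinearSystem μ A p x₀ s x w) (t : ℕ) (g : Fin k → ℝ≥0∞) : ∫⁻ ω, g (s t ω) ∂μ = ∑ i, g i * ENNReal.ofReal (p i) := by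
  rw [← lintegral_map (μ := μ) (f := g) (g := s t) (measurable_of_finite g) (hsys.measurable_mode t),
    lintegral_fintype]
  refine Finset.sum_congr rfl fun i _ => ?_
  rw [Measure.map_apply (hsys.measurable_mode t) (measurableSet_singleton i), ← hsys.mode_law t i,
    ofReal_measureReal]
  rfl

theorem IsSwitchedLinearSystem.sum_prob [IsProbabilityMeasure μ]
    (hsys : IsSwitchedLinearSystem μ A p x₀ s x w) :
    ∑ i, p i = 1 := by
  have h := hsys.lintegral_mode 0 fun _ => 1
  simp only [lintegral_const, measure_univ, one_mul] at h
  rw [← ENNReal.ofReal_sum_of_nonneg fun i _ => (hsys.prob_pos i).le] at h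
  exact (ENNReal.ofReal_eq_one.1 h.symm)

theorem sigmaMax_nonneg (B : Matrix (Fin n) (Fin n) ℝ) : 0 ≤ sigmaMax B := norm_nonneg _

/-- The products of the gains along the realised modes are summable in mean. -/
theorem IsSwitchedLinearSystem.lintegral_affineRec_le [IsProbabilityMeasure μ]
    (hsys : IsSwitchedLinearSystem μ A p x₀ s x w) {θ ρ : ℝ}
    (hρ : ∑ i, p i * sigmaMax (A i) ^ θ = ρ) (hρ1 : ρ < 1) (t : ℕ) :
    ∫⁻ ω, ENNReal.ofReal (affineRec (fun u => sigmaMax (A (s u ω)) ^ θ) t) ∂μ ≤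
      ENNReal.ofReal (1 / (1 - ρ)) := by
  have hσ : ∀ i, 0 ≤ sigmaMax (A i) ^ θ := fun i => Real.rpow_nonneg (sigmaMax_nonneg _) _
  have hρ0 : 0 ≤ ρ := hρ ▸ Finset.sum_nonneg fun i _ => mul_nonneg (hsys.prob_pos i).le (hσ i)
  have hgain : ∀ m : MeasurableSpace Ω, ∀ u, Measurable[m] (s u) →
      Measurable[m] fun ω => sigmaMax (A (s u ω)) ^ θ := fun m u hu =>
    (measurable_of_finite fun i => sigmaMax (A i) ^ θ).comp hu
  have hmeas : ∀ t, Measurable[historyBeforeSwitch x s t]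
      fun ω => affineRec (fun u => sigmaMax (A (s u ω)) ^ θ) t := by
    intro t
    induction t with
    | zero => exact measurable_const
    | succ t ih =>
      exact ((hgain _ t (measurable_mode_before t.lt_succ_self)).mul
        (ih.mono (before_mono t.le_succ) le_rfl)).add_const _
  induction t with
  | zero =>
    simp only [affineRec, lintegral_const, measure_univ, mul_one]
    exact ENNReal.ofReal_le_ofReal (by rw [le_div_iff₀ (by linarith)]; linarith)
  | succ t ih =>
    have h1 : ∀ ω, ENNReal.ofReal (affineRec (fun u => sigmaMax (A (s u ω)) ^ θ) (t + 1)) =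
        ENNReal.ofReal (sigmaMax (A (s t ω)) ^ θ) *
          ENNReal.ofReal (affineRec (fun u => sigmaMax (A (s u ω)) ^ θ) t) + 1 := fun ω => by
      have h0 := affineRec_pos (r := fun u => sigmaMax (A (s u ω)) ^ θ) (fun u => hσ _) t
      rw [affineRec, ENNReal.ofReal_add (mul_nonneg (hσ _) h0.le) zero_le_one,
        ENNReal.ofReal_mul (hσ _), ENNReal.ofReal_one]
    simp_rw [h1]
    -- The recursion at t uses only modes before t, so the gain of s_t factors out with mean ρ. The
    -- induction bound 1/(1 - ρ) is the fixed point of y ↦ ρ y + 1.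
    have hprod := lintegral_mul_eq_lintegral_mul_lintegral_of_independent_measurableSpace
      (hsys.measurable_mode t).comap_le (hsys.before_le t) (hsys.mode_indep_past t)
      (f := fun ω => ENNReal.ofReal (sigmaMax (A (s t ω)) ^ θ))
      (g := fun ω => ENNReal.ofReal (affineRec (fun u => sigmaMax (A (s u ω)) ^ θ) t))
      (ENNReal.measurable_ofReal.comp (hgain _ t (comap_measurable _)))
      (ENNReal.measurable_ofReal.comp (hmeas t))
    rw [lintegral_add_right _ measurable_const, hprod,
      hsys.lintegral_mode t fun i => ENNReal.ofReal (sigmaMax (A i) ^ θ)]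
    have h2 : ∑ i, ENNReal.ofReal (sigmaMax (A i) ^ θ) * ENNReal.ofReal (p i) =
        ENNReal.ofReal ρ := by
      rw [← hρ, ENNReal.ofReal_sum_of_nonneg fun i _ => mul_nonneg (hsys.prob_pos i).le (hσ i)]
      refine Finset.sum_congr rfl fun i _ => ?_
      rw [mul_comm, ENNReal.ofReal_mul (hsys.prob_pos i).le]
    rw [h2]
    calc _ ≤ ENNReal.ofReal ρ * ENNReal.ofReal (1 / (1 - ρ)) + 1 := by
          gcongr; simp
      _ = ENNReal.ofReal (1 / (1 - ρ)) := by
          rw [← ENNReal.ofReal_mul hρ0, ← ENNReal.ofReal_one,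
            ← ENNReal.ofReal_add (mul_nonneg hρ0 (by rw [one_div, inv_nonneg]; linarith)) zero_le_one]
          congr 1
          have : 1 - ρ ≠ 0 := by linarith
          field_simp
          ring

/-- Under the stability assumption the state grows at most polynomially. -/
theorem IsLocalNoise.ae_state_le [IsProbabilityMeasure μ]
    {hsys : IsSwitchedLinearSystem μ A p x₀ s x w} {α : ℝ} {M : ℝ≥0∞}
    {w' : ℕ → Ω → EuclideanSpace ℝ (Fin n)} (hw : IsLocalNoise hsys α M w')
    (hstab : StabilityAssumption A p) :
    ∀ᵐ ω ∂μ, (∀ t, w' t ω = w t ω) →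
      ∃ C κ : ℝ, ∀ t : ℕ, ‖x t ω‖ ≤ C * ((t : ℝ) + 1) ^ κ := by
  obtain ⟨θ, hθ0, hθ1, hθ⟩ := exists_rpow_mean_lt_one (fun i => sigmaMax_nonneg (A i))
    hsys.prob_pos hsys.sum_prob hstab
  have hσ : ∀ i, 0 ≤ sigmaMax (A i) ^ θ := fun i => Real.rpow_nonneg (sigmaMax_nonneg _) _
  set r : Ω → ℕ → ℝ := fun ω u => sigmaMax (A (s u ω)) ^ θ with hr
  have hrm : ∀ t, Measurable fun ω => affineRec (r ω) t := by
    intro t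
    induction t with
    | zero => exact measurable_const
    | succ t ih =>
      exact ((((measurable_of_finite fun i => sigmaMax (A i) ^ θ).comp
        (hsys.measurable_mode t))).mul ih).add_const _
  have hpos : ∀ ω t, 0 < affineRec (r ω) t := fun ω t => affineRec_pos (fun u => hσ _) t
  have hw'm : ∀ t, Measurable (w' t) := fun t =>
    (hw.measurable_before t).mono (hsys.before_le _) le_rfl
  filter_upwards [ae_exists_le_mul_sq (μ := μ) (a := fun t ω => affineRec (r ω) t)
      (fun t => (hrm t).aestronglyMeasurable) ENNReal.ofReal_ne_top (fun t => by
        refine le_trans (le_of_eq (lintegral_congr fun ω => ?_))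
          (hsys.lintegral_affineRec_le rfl hθ t)
        rw [Real.enorm_of_nonneg (hpos ω t).le]),
    ae_exists_le_mul_sq (μ := μ) (a := fun t ω => ‖w' t ω‖ ^ 2)
      (fun t => ((hw'm t).norm.pow_const 2).aestronglyMeasurable) (M := 1 + M)
      (by have := hw.ne_top; finiteness) (fun t => by
        have h := setLIntegral_rpow_le_of_le (μ := μ) (f := w' t) (s := Set.univ) (M := M)
          zero_le_two hw.two_lt.le (by simpa using hw.moment t)
        simp only [Measure.restrict_univ, measure_univ, mul_one] at h
        refine le_trans (le_of_eq (lintegral_congr fun ω => ?_)) h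
        rw [enorm_pow, enorm_norm, ENNReal.rpow_ofNat])] with ω ⟨C₁, h1⟩ ⟨C₂, h2⟩ heq
  -- Large enough that D² ≥ C₂, for the noise bound, and D ≥ ‖x₀‖, for the base of the induction.
  set D : ℝ := 1 + |C₂| + ‖x₀‖ with hD
  have hD0 : 0 < D := by positivity
  have hwD : ∀ t : ℕ, ‖w t ω‖ ≤ D * (t + 1) := fun t => by
    have h3 := (le_abs_self _).trans (h2 t)
    rw [heq t] at h3
    have h4 : 0 ≤ D * ((t : ℝ) + 1) := by positivity
    refine abs_le_of_sq_le_sq' ?_ h4 |>.2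
    refine h3.trans ?_
    rw [mul_pow]
    refine mul_le_mul_of_nonneg_right ?_ (by positivity)
    have := norm_nonneg x₀
    nlinarith [le_abs_self C₂, abs_nonneg C₂]
  -- Since θ ≤ 1, the θ-th power is subadditive and the state recursion becomes affine with gains r;
  -- the growing noise bound is a monotone prefactor.
  have key : ∀ t : ℕ, ‖x t ω‖ ^ θ ≤ affineRec (r ω) t * (D * (t + 1)) ^ θ := by
    intro t
    induction t with
    | zero =>
      rw [hsys.initial, affineRec, one_mul]
      refine Real.rpow_le_rpow (norm_nonneg _) ?_ hθ0.le
      push_cast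
      linarith [abs_nonneg C₂]
    | succ t ih =>
      have h3 : ‖x (t + 1) ω‖ ≤ sigmaMax (A (s t ω)) * ‖x t ω‖ + ‖w t ω‖ := by
        rw [hsys.dynamics]
        refine (norm_add_le _ _).trans (add_le_add ?_ le_rfl)
        exact (act (A (s t ω))).le_opNorm _
      have h4 : 0 ≤ sigmaMax (A (s t ω)) * ‖x t ω‖ :=
        mul_nonneg (sigmaMax_nonneg _) (norm_nonneg _)
      have hmono : (D * ((t : ℝ) + 1)) ^ θ ≤ (D * (((t + 1 : ℕ) : ℝ) + 1)) ^ θ := by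
        refine Real.rpow_le_rpow (by positivity) ?_ hθ0.le
        push_cast
        nlinarith
      calc ‖x (t + 1) ω‖ ^ θ ≤ (sigmaMax (A (s t ω)) * ‖x t ω‖ + ‖w t ω‖) ^ θ :=
            Real.rpow_le_rpow (norm_nonneg _) h3 hθ0.le
        _ ≤ (sigmaMax (A (s t ω)) * ‖x t ω‖) ^ θ + ‖w t ω‖ ^ θ :=
            Real.rpow_add_le_add_rpow h4 (norm_nonneg _) hθ0.le hθ1
        _ ≤ r ω t * (affineRec (r ω) t * (D * (t + 1)) ^ θ) + (D * (t + 1)) ^ θ := by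
            rw [Real.mul_rpow (sigmaMax_nonneg _) (norm_nonneg _)]
            exact add_le_add (mul_le_mul_of_nonneg_left ih (hσ _))
              (Real.rpow_le_rpow (norm_nonneg _) (hwD t) hθ0.le)
        _ = affineRec (r ω) (t + 1) * (D * (t + 1)) ^ θ := by rw [affineRec]; ring
        _ ≤ _ := mul_le_mul_of_nonneg_left hmono (hpos ω _).le
  refine ⟨|C₁| ^ θ⁻¹ * D, 2 * θ⁻¹ + 1, fun t => ?_⟩
  have ht : (0 : ℝ) < t + 1 := by positivity
  have h5 : affineRec (r ω) t ≤ |C₁| * ((t : ℝ) + 1) ^ 2 :=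
    ((le_abs_self _).trans (h1 t)).trans
      (mul_le_mul_of_nonneg_right (le_abs_self _) (by positivity))
  have h6 : (0 : ℝ) ≤ (D * (t + 1)) ^ θ := Real.rpow_nonneg (by positivity) _
  calc ‖x t ω‖ = (‖x t ω‖ ^ θ) ^ θ⁻¹ := (Real.rpow_rpow_inv (norm_nonneg _) hθ0.ne').symm
    _ ≤ (|C₁| * ((t : ℝ) + 1) ^ 2 * (D * (t + 1)) ^ θ) ^ θ⁻¹ :=
        Real.rpow_le_rpow (Real.rpow_nonneg (norm_nonneg _) _)
          ((key t).trans (mul_le_mul_of_nonneg_right h5 h6)) (inv_nonneg.2 hθ0.le)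
    _ = |C₁| ^ θ⁻¹ * D * ((t : ℝ) + 1) ^ (2 * θ⁻¹ + 1) := by
        rw [Real.mul_rpow (by positivity) h6, Real.mul_rpow (abs_nonneg _) (by positivity),
          Real.rpow_rpow_inv (by positivity) hθ0.ne', ← Real.rpow_natCast, ← Real.rpow_mul ht.le,
          Real.rpow_add ht, Real.rpow_one]
        push_cast
        ring

end Growth

/-! ### Pathwise bounds: determinant size and uniform excitation. -/

section Deterministic

variable {n : ℕ}

theorem log_add_two_le {T : ℕ} (hT : 2 ≤ T) : Real.log ((T : ℝ) + 2) ≤ 2 * Real.log T := by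
  have hT' : (2 : ℝ) ≤ T := by exact_mod_cast hT
  have h : Real.log ((T : ℝ) ^ 2) = 2 * Real.log T := by rw [Real.log_pow]; norm_num
  rw [← h]
  exact Real.log_le_log (by linarith) (by nlinarith)

/-- Polynomially growing regressors have a Gram determinant of polynomial size. -/
theorem exists_log_det_gram_le {z : ℕ → Fin n → ℝ} {C κ : ℝ}
    (hz : ∀ (t : ℕ) j, |z t j| ≤ C * ((t : ℝ) + 1) ^ κ) :
    ∃ D, 0 ≤ D ∧ ∀ T : ℕ, 2 ≤ T → ∀ N ≤ T + 1, 1 + Real.log (gram z N).det ≤ D * Real.log T := by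
  set c : ℝ := 1 + |C| with hc
  have hc1 : 1 ≤ c := by linarith [abs_nonneg C]
  set E : ℝ := 1 + Real.log (Nat.factorial n) + n * (2 * Real.log c) with hE
  have hfac : 0 ≤ Real.log (Nat.factorial n : ℝ) :=
    Real.log_nonneg (by exact_mod_cast Nat.factorial_pos n)
  have hE0 : 0 ≤ E := by
    have := Real.log_nonneg hc1
    positivity
  have hl2 : 0 < Real.log 2 := Real.log_pos (by norm_num)
  -- Constants are absorbed using log T ≥ log 2, and log(T + 2) ≤ 2 log T doubles the coefficients 1
  -- and 2|κ|. The range N ≤ T + 1 serves both the design bound (N = T) and the estimator (N = T +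
  -- 1).
  refine ⟨E / Real.log 2 + n * (2 + 4 * |κ|), by positivity, fun T hT N hN => ?_⟩
  have hT' : (2 : ℝ) ≤ T := by exact_mod_cast hT
  set R : ℝ := c * ((T : ℝ) + 2) ^ |κ| with hR
  have hpow1 : 1 ≤ ((T : ℝ) + 2) ^ |κ| := Real.one_le_rpow (by linarith) (abs_nonneg _)
  have hR1 : 1 ≤ R := one_le_mul_of_one_le_of_one_le hc1 hpow1
  have hbound : ∀ t < N, ∀ j, |z t j| ≤ R := fun t ht j => by
    have htT : (t : ℝ) ≤ T := by exact_mod_cast (by omega : t ≤ T)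
    refine (hz t j).trans ?_
    have h1 : ((t : ℝ) + 1) ^ κ ≤ ((T : ℝ) + 2) ^ |κ| :=
      (Real.rpow_le_rpow_of_exponent_le (by linarith [t.cast_nonneg (α := ℝ)]) (le_abs_self κ)).trans
        (Real.rpow_le_rpow (by positivity) (by linarith) (abs_nonneg _))
    refine mul_le_mul ?_ h1 (by positivity) (by linarith)
    linarith [le_abs_self C]
  have h2 := log_det_gram_le z N hR1 hbound
  have hN' : ((N : ℝ) + 1) * R ^ 2 ≤ ((T : ℝ) + 2) * R ^ 2 := by
    have : (N : ℝ) ≤ T + 1 := by exact_mod_cast hN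
    exact mul_le_mul_of_nonneg_right (by linarith) (sq_nonneg _)
  have h3 : Real.log (((N : ℝ) + 1) * R ^ 2) ≤
      Real.log ((T : ℝ) + 2) + 2 * (Real.log c + |κ| * Real.log ((T : ℝ) + 2)) := by
    refine (Real.log_le_log (by positivity) hN').trans (le_of_eq ?_)
    rw [Real.log_mul (by positivity) (by positivity), Real.log_pow, hR,
      Real.log_mul (by positivity) (by positivity), Real.log_rpow (by positivity)]
    norm_num
  have h4 := log_add_two_le hT
  have h5 : E ≤ E / Real.log 2 * Real.log T := by
    rw [div_mul_eq_mul_div, le_div_iff₀ hl2]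
    exact mul_le_mul_of_nonneg_left (Real.log_le_log (by norm_num) hT') hE0
  have h6 : |κ| * Real.log ((T : ℝ) + 2) ≤ |κ| * (2 * Real.log T) :=
    mul_le_mul_of_nonneg_left h4 (abs_nonneg _)
  have h7 : (n : ℝ) * Real.log (((N : ℝ) + 1) * R ^ 2) ≤
      n * (2 * Real.log c + (2 + 4 * |κ|) * Real.log T) :=
    mul_le_mul_of_nonneg_left (by linarith) n.cast_nonneg
  linarith

theorem sq_dotProduct_le (u v : Fin n → ℝ) : (u ⬝ᵥ v) ^ 2 ≤ (u ⬝ᵥ u) * (v ⬝ᵥ v) := by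
  simp only [dotProduct, ← pow_two]
  exact Finset.sum_mul_sq_le_sq_mul_sq _ _ _

theorem dotProduct_self_nonneg_real (v : Fin n → ℝ) : 0 ≤ v ⬝ᵥ v :=
  Finset.sum_nonneg fun _ _ => mul_self_nonneg _

/-- Persistent excitation in every direction is uniform in the direction. -/
theorem exists_uniform_excitation {y : ℕ → Fin n → ℝ} {W : ℝ}
    (hW : ∀ T : ℕ, ∑ t ∈ Finset.range T, y t ⬝ᵥ y t ≤ W * (T + 1))
    (h : ∀ v : Fin n → ℝ, v ≠ 0 → ∃ c > 0, ∀ᶠ T : ℕ in atTop,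
      c * T ≤ ∑ t ∈ Finset.range T, (v ⬝ᵥ y t) ^ 2) :
    ∃ c > 0, ∀ᶠ T : ℕ in atTop, ∀ v : Fin n → ℝ,
      c * T * (v ⬝ᵥ v) ≤ ∑ t ∈ Finset.range T, (v ⬝ᵥ y t) ^ 2 := by
  have hcompact : IsCompact {v : Fin n → ℝ | v ⬝ᵥ v = 1} := by
    refine Metric.isCompact_of_isClosed_isBounded
      (isClosed_eq (continuous_id.dotProduct continuous_id) continuous_const) ?_
    refine (Metric.isBounded_closedBall (x := 0) (r := 1)).subset fun v hv => ?_
    rw [mem_closedBall_zero_iff, pi_norm_le_iff_of_nonneg zero_le_one]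
    intro j
    have h1 : v j * v j ≤ 1 := by
      rw [← hv]
      exact Finset.single_le_sum (f := fun j => v j * v j) (fun _ _ => mul_self_nonneg _)
        (Finset.mem_univ j)
    rw [Real.norm_eq_abs, abs_le]
    constructor <;> nlinarith
  have key : ∃ c > 0, ∀ᶠ T : ℕ in atTop, ∀ v ∈ {v : Fin n → ℝ | v ⬝ᵥ v = 1},
      c * T ≤ ∑ t ∈ Finset.range T, (v ⬝ᵥ y t) ^ 2 := by
    refine hcompact.induction_on (p := fun S => ∃ c > 0, ∀ᶠ T : ℕ in atTop, ∀ v ∈ S,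
      c * T ≤ ∑ t ∈ Finset.range T, (v ⬝ᵥ y t) ^ 2) ⟨1, one_pos, by simp⟩ ?_ ?_ ?_
    · rintro S S' hSS' ⟨c, hc, hS'⟩
      exact ⟨c, hc, hS'.mono fun T hT v hv => hT v (hSS' hv)⟩
    · rintro S S' ⟨c, hc, hS⟩ ⟨c', hc', hS'⟩
      refine ⟨min c c', lt_min hc hc', ?_⟩
      filter_upwards [hS, hS'] with T h1 h2 v hv
      rcases hv with hv | hv
      · exact (mul_le_mul_of_nonneg_right (min_le_left _ _) T.cast_nonneg).trans (h1 v hv)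
      · exact (mul_le_mul_of_nonneg_right (min_le_right _ _) T.cast_nonneg).trans (h2 v hv)
    · intro v hv
      have hv0 : v ≠ 0 := by rintro rfl; simp at hv
      obtain ⟨c, hc, hT⟩ := h v hv0
      set W' : ℝ := |W| + 1 with hW'
      have hW'0 : 0 < W' := by positivity
      -- From (v·y)²/2 - ((u-v)·y)² ≤ (u·y)², moving from v to u costs at most (c/8W')(2W'T) = cT/4,
      -- so half of cT/2 survives.
      have hnhds : {u : Fin n → ℝ | (u - v) ⬝ᵥ (u - v) < c / (8 * W')} ∈ 𝓝 v := by
        refine IsOpen.mem_nhds (isOpen_lt ((continuous_id.sub continuous_const).dotProduct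
          (continuous_id.sub continuous_const)) continuous_const) ?_
        simp only [Set.mem_ofPred_eq, sub_self, dotProduct_zero]
        positivity
      refine ⟨_, mem_nhdsWithin_of_mem_nhds hnhds, c / 4, by positivity, ?_⟩
      filter_upwards [hT, eventually_ge_atTop 1] with T hT hT1 u hu
      have hT1' : (1 : ℝ) ≤ T := by exact_mod_cast hT1
      have h1 : ∀ t, (v ⬝ᵥ y t) ^ 2 / 2 - (c / (8 * W')) * (y t ⬝ᵥ y t) ≤ (u ⬝ᵥ y t) ^ 2 := fun t => by
        have h2 := sq_dotProduct_le (u - v) (y t)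
        have h3 := mul_le_mul_of_nonneg_right (le_of_lt hu) (dotProduct_self_nonneg_real (y t))
        rw [sub_dotProduct] at h2
        nlinarith [sq_nonneg (2 * (u ⬝ᵥ y t) - v ⬝ᵥ y t)]
      have h4 := Finset.sum_le_sum fun t (_ : t ∈ Finset.range T) => h1 t
      rw [Finset.sum_sub_distrib, ← Finset.sum_div, ← Finset.mul_sum] at h4
      have h5 : ∑ t ∈ Finset.range T, y t ⬝ᵥ y t ≤ W' * (2 * T) := by
        refine (hW T).trans (mul_le_mul ?_ (by linarith) (by positivity) (by positivity))
        linarith [le_abs_self W]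
      have h6 : c / (8 * W') * ∑ t ∈ Finset.range T, y t ⬝ᵥ y t ≤ c / (8 * W') * (W' * (2 * T)) :=
        mul_le_mul_of_nonneg_left h5 (by positivity)
      have h7 : c / (8 * W') * (W' * (2 * T)) = c / 4 * T := by field_simp; ring
      linarith
  obtain ⟨c, hc, hT⟩ := key
  refine ⟨c, hc, hT.mono fun T hT v => ?_⟩
  by_cases hv : v = 0
  · simp [hv]
  have hvv : 0 < v ⬝ᵥ v := by
    refine lt_of_le_of_ne (dotProduct_self_nonneg_real v) fun h0 => hv ?_
    exact dotProduct_self_eq_zero.1 h0.symm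
  have h1 := hT ((Real.sqrt (v ⬝ᵥ v))⁻¹ • v) (by
    simp only [Set.mem_ofPred_eq, smul_dotProduct, dotProduct_smul, smul_eq_mul]
    rw [← mul_assoc, ← mul_inv, Real.mul_self_sqrt hvv.le, inv_mul_cancel₀ hvv.ne'])
  simp only [smul_dotProduct, smul_eq_mul, mul_pow, ← Finset.mul_sum, inv_pow,
    Real.sq_sqrt hvv.le] at h1
  rw [inv_mul_eq_div, le_div_iff₀ hvv] at h1
  exact h1

theorem dotProduct_noiseCov_mulVec {Ω : Type*} (w : ℕ → Ω → EuclideanSpace ℝ (Fin n)) (T : ℕ) (ω : Ω) 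
    (v : Fin n → ℝ) :
    v ⬝ᵥ (noiseCov w T ω).mulVec v =
      1 / (T : ℝ) * ∑ t ∈ Finset.range T, (v ⬝ᵥ (w t ω).ofLp) ^ 2 := by
  rw [noiseCov, Matrix.smul_mulVec, dotProduct_smul, Matrix.sum_mulVec, dotProduct_sum, smul_eq_mul]
  congr 1
  refine Finset.sum_congr rfl fun t _ => ?_
  rw [Matrix.vecMulVec_mulVec]
  simp [dotProduct_comm (w t ω).ofLp v, pow_two]

end Deterministic

/-! ### Excitation by the noise, and its thinning by the next mode. -/

section Excitation

variable {Ω : Type*} [mΩ : MeasurableSpace Ω] {μ : Measure Ω} {n k : ℕ}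
  {A : Fin k → Matrix (Fin n) (Fin n) ℝ} {p : Fin k → ℝ} {x₀ : EuclideanSpace ℝ (Fin n)}
  {s : ℕ → Ω → Fin k} {x w : ℕ → Ω → EuclideanSpace ℝ (Fin n)}

/-- Half of vᵀCv lies strictly below the lower limit. The constant depends on v;
`exists_uniform_excitation` removes this. -/
theorem NoiseAssumption.ae_excitation (hnoise : NoiseAssumption μ s x w) :
    ∀ᵐ ω ∂μ, ∀ v : Fin n → ℝ, v ≠ 0 → ∃ c > 0, ∀ᶠ T : ℕ in atTop,
      c * T ≤ ∑ t ∈ Finset.range T, (v ⬝ᵥ (w t ω).ofLp) ^ 2 := by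
  obtain ⟨C, hC, h⟩ := hnoise.excitation
  filter_upwards [h] with ω hω v hv
  have hpos : 0 < v ⬝ᵥ C.mulVec v := by simpa using hC.dotProduct_mulVec_pos hv
  refine ⟨(v ⬝ᵥ C.mulVec v) / 2, by positivity, ?_⟩
  have hlt : (((v ⬝ᵥ C.mulVec v) / 2 : ℝ) : EReal) < liminf (fun T : ℕ =>
      ((v ⬝ᵥ (noiseCov w T ω).mulVec v : ℝ) : EReal)) atTop :=
    lt_of_lt_of_le (EReal.coe_lt_coe_iff.2 (by linarith)) (hω v)
  filter_upwards [eventually_lt_of_lt_liminf hlt, eventually_ge_atTop 1] with T hT hT1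
  have hT' : (0 : ℝ) < T := by exact_mod_cast hT1
  have h1 := EReal.coe_lt_coe_iff.1 hT
  rw [dotProduct_noiseCov_mulVec, one_div, inv_mul_eq_div, lt_div_iff₀ hT'] at h1
  exact h1.le

variable [IsProbabilityMeasure μ] {hsys : IsSwitchedLinearSystem μ A p x₀ s x w} {α : ℝ}
  {M : ℝ≥0∞} {w' : ℕ → Ω → EuclideanSpace ℝ (Fin n)}

theorem IsLocalNoise.ae_sum_sq_le (hw : IsLocalNoise hsys α M w') :
    ∀ᵐ ω ∂μ, ∃ W, ∀ T : ℕ,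
      ∑ t ∈ Finset.range T, (w' t ω).ofLp ⬝ᵥ (w' t ω).ofLp ≤ W * (T + 1) := by
  have h : ∀ j, ∀ᵐ ω ∂μ, ∃ C, ∀ T, ∑ t ∈ Finset.range T, (1 : ℝ) * w' t ω j ^ 2 ≤
      C * (1 + ∑ t ∈ Finset.range T, (1 : ℝ)) := fun j =>
    (hw.isNoise j).ae_quadratic_sum_le hw.two_lt hw.le_four hw.ne_top (h := fun _ _ => 1)
      (fun _ => stronglyMeasurable_const) (fun _ _ => zero_le_one) fun _ _ => le_rfl
  filter_upwards [ae_all_iff.2 h] with ω hω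
  choose C hC using hω
  refine ⟨∑ j, C j, fun T => ?_⟩
  simp only [dotProduct]
  rw [Finset.sum_comm, Finset.sum_mul]
  refine Finset.sum_le_sum fun j _ => ?_
  have := hC j T
  simp only [one_mul, Finset.sum_const, Finset.card_range, nsmul_eq_mul, mul_one] at this
  simpa [pow_two, add_comm] using this

/-- The indicator of the next mode averages out in the noise covariance. -/
theorem IsLocalNoise.ae_thinned_cov_sub_le (hw : IsLocalNoise hsys α M w') (i : Fin k)
    (a b : Fin n) :
    ∃ κ : ℝ, κ < 1 ∧ ∀ᵐ ω ∂μ, ∃ C, ∀ T : ℕ,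
      |∑ t ∈ Finset.range T, ((if s (t + 1) ω = i then 1 else 0) - p i) * (w' t ω a * w' t ω b)| ≤
        C * ((T : ℝ) + 1) ^ κ := by
  have hα0 : 0 < α := by linarith [hw.two_lt]
  -- Midway between 2/α and 1: the first makes the normalised moments of order α/2 summable, the
  -- second makes the error o(T).
  set κ : ℝ := (1 + 2 / α) / 2 with hκ
  have hα2 : 2 / α < 1 := (div_lt_one hα0).2 hw.two_lt
  have hκ0 : 0 < κ := by positivity
  have hκp : 1 < κ * (α / 2) := by
    have : κ * (α / 2) = (α / 2 + 1) / 2 := by rw [hκ]; field_simp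
    linarith [hw.two_lt]
  refine ⟨κ, by linarith, ?_⟩
  set K : ℕ → ℝ := fun t => ((t : ℝ) + 1) ^ κ with hK
  have hKpos : ∀ t, 0 < K t := fun t => Real.rpow_pos_of_pos (by positivity) _
  set e : ℕ → Ω → ℝ := fun t ω => (if s (t + 1) ω = i then 1 else 0) - p i with he
  set g : ℕ → Ω → ℝ := fun t ω => (K (t + 1))⁻¹ * (w' t ω a * w' t ω b) with hg
  have hp1 : p i ≤ 1 := hsys.mode_law 0 i ▸ measureReal_le_one
  have hp0 := hsys.prob_pos i
  have he1 : ∀ t ω, |e t ω| ≤ 1 := fun t ω => by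
    simp only [he]; split_ifs <;> rw [abs_le] <;> constructor <;> linarith
  have hesm : ∀ t, Measurable[MeasurableSpace.comap (s (t + 1)) inferInstance] (e t) := fun t =>
    (measurable_of_finite fun l : Fin k => (if l = i then (1 : ℝ) else 0) - p i).comp
      (comap_measurable (s (t + 1)))
  have heint : ∀ t, Integrable (e t) μ := fun t =>
    Integrable.of_bound ((hesm t).mono (hsys.measurable_mode _).comap_le le_rfl).aestronglyMeasurable
      1 (Eventually.of_forall (he1 t))
  have hcoord : ∀ j : Fin n, Measurable fun v : EuclideanSpace ℝ (Fin n) => v j := fun j =>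
    (EuclideanSpace.proj (𝕜 := ℝ) j).continuous.measurable
  -- Roles are reversed here: the noise products are predictable weights, and the centred indicator
  -- of the next mode is the martingale increment.
  have hgm : ∀ t, StronglyMeasurable[hsys.beforeFiltration t] (g t) := fun t =>
    ((((hcoord a).comp (hw.measurable_before t)).mul
      ((hcoord b).comp (hw.measurable_before t))).const_mul _).stronglyMeasurable
  have hge : ∀ t ω, ‖(g t * e t) ω‖ₑ ≤ ENNReal.ofReal (K (t + 1))⁻¹ * ‖w' t ω‖ₑ ^ (2 : ℝ) :=
    fun t ω => by
      have h1 : ‖e t ω‖ₑ ≤ 1 := by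
        rw [← ofReal_norm]; exact ENNReal.ofReal_le_one.2 (he1 t ω)
      rw [Pi.mul_apply, enorm_mul, hg]
      simp only [enorm_mul]
      rw [Real.enorm_of_nonneg (inv_nonneg.2 (hKpos _).le), ENNReal.rpow_ofNat, pow_two]
      calc _ ≤ ENNReal.ofReal (K (t + 1))⁻¹ * (‖w' t ω‖ₑ * ‖w' t ω‖ₑ) * 1 := by
            gcongr <;> exact enorm_coord_le _ _
        _ = _ := mul_one _
  have hgeint : ∀ t, Integrable (g t * e t) μ := fun t => by
    refine ⟨(((hgm t).mono (hsys.beforeFiltration.le t)).aestronglyMeasurable).mul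
      (heint t).aestronglyMeasurable, ?_⟩
    rw [hasFiniteIntegral_iff_enorm]
    refine lt_of_le_of_lt (lintegral_mono (hge t)) ?_
    have h := setLIntegral_rpow_le_of_le (μ := μ) (f := w' t) (s := Set.univ) (M := M)
      zero_le_two hw.two_lt.le (by simpa using hw.moment t)
    simp only [Measure.restrict_univ, measure_univ, mul_one] at h
    rw [lintegral_const_mul' _ _ ENNReal.ofReal_ne_top]
    exact ENNReal.mul_lt_top ENNReal.ofReal_lt_top
      (h.trans_lt (ENNReal.add_lt_top.2 ⟨ENNReal.one_lt_top, hw.ne_top.lt_top⟩))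
  have hsum : ∑' t, ∫⁻ ω, ‖(g t * e t) ω‖ₑ ^ (α / 2) ∂μ ≠ ∞ := by
    have h1 : ∀ t : ℕ, ∫⁻ ω, ‖(g t * e t) ω‖ₑ ^ (α / 2) ∂μ ≤
        ENNReal.ofReal ((((t : ℝ) + 2) ^ (κ * (α / 2)))⁻¹) * M := fun t => by
      refine (lintegral_mono fun ω => ENNReal.rpow_le_rpow (hge t ω) (by positivity)).trans ?_
      have h2 : ∀ ω, (ENNReal.ofReal (K (t + 1))⁻¹ * ‖w' t ω‖ₑ ^ (2 : ℝ)) ^ (α / 2) =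
          ENNReal.ofReal ((((t : ℝ) + 2) ^ (κ * (α / 2)))⁻¹) * ‖w' t ω‖ₑ ^ α := fun ω => by
        rw [ENNReal.mul_rpow_of_nonneg _ _ (by positivity), ← ENNReal.rpow_mul,
          ENNReal.ofReal_rpow_of_nonneg (inv_nonneg.2 (hKpos _).le) (by positivity),
          Real.inv_rpow (hKpos _).le]
        have h3 : K (t + 1) = ((t : ℝ) + 2) ^ κ := by simp only [hK]; push_cast; ring_nf
        rw [h3, ← Real.rpow_mul (by positivity)]
        congr 2
        ring
      simp_rw [h2]
      rw [lintegral_const_mul' _ _ ENNReal.ofReal_ne_top]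
      exact mul_le_mul_right (hw.moment t) _
    refine ne_top_of_le_ne_top ?_ (ENNReal.tsum_le_tsum h1)
    rw [ENNReal.tsum_mul_right]
    refine ENNReal.mul_ne_top ?_ hw.ne_top
    have hs : Summable fun t : ℕ => (((t : ℝ) + 2) ^ (κ * (α / 2)))⁻¹ := by
      have := (summable_nat_add_iff 2).2 (Real.summable_nat_rpow_inv.2 hκp)
      simpa using this
    exact hs.tsum_ofReal_ne_top
  have hce : ∀ t, μ[g t * e t | hsys.beforeFiltration t] =ᵐ[μ] 0 := fun t => by
    have h1 := condExp_mul_of_stronglyMeasurable_left (hgm t) (hgeint t) (heint t)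
    have h2 := condExp_indep_eq (hsys.measurable_mode (t + 1)).comap_le (hsys.before_le (t + 1))
      (hesm t).stronglyMeasurable (hsys.mode_indep_past (t + 1))
    have h3 : ∫ ω, e t ω ∂μ = 0 := by
      have h4 : e t = fun ω => ({ω | s (t + 1) ω = i}.indicator (1 : Ω → ℝ)) ω - p i := by
        ext ω; by_cases h : s (t + 1) ω = i <;> simp [he, h]
      have hms : MeasurableSet {ω | s (t + 1) ω = i} :=
        (hsys.measurable_mode _) (measurableSet_singleton i)
      rw [h4]
      change ∫ ω, (({ω | s (t + 1) ω = i}.indicator (1 : Ω → ℝ)) ω - p i) ∂μ = 0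
      have hi : Integrable ({ω | s (t + 1) ω = i}.indicator (1 : Ω → ℝ)) μ :=
        (integrable_const (1 : ℝ)).indicator hms
      rw [integral_sub hi (integrable_const _), integral_indicator_one hms, hsys.mode_law]
      simp
    filter_upwards [h1, h2] with ω h1 h2
    refine h1.trans ?_
    rw [Pi.mul_apply]
    have h5 : (μ[e t | hsys.beforeFiltration t]) ω = 0 := h2.trans h3
    rw [h5, mul_zero, Pi.zero_apply]
  have hadap : ∀ t, StronglyMeasurable[hsys.beforeFiltration (t + 1)] (g t * e t) := fun t =>
    ((hgm t).mono (hsys.beforeFiltration.mono t.le_succ)).mul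
      ((hesm t).mono (measurable_mode_before (Nat.lt_succ_self (t + 1))).comap_le
        le_rfl).stronglyMeasurable
  filter_upwards [ae_bounded_centered_sums hsys.beforeFiltration hadap hgeint
    (by linarith [hw.two_lt] : 1 ≤ α / 2) (by linarith [hw.le_four]) hsum,
    ae_all_iff.2 hce] with ω ⟨C, hC⟩ h0
  refine ⟨2 * C, fun T => ?_⟩
  have hmono : Monotone K := fun t u htu => by
    refine Real.rpow_le_rpow (by positivity) ?_ hκ0.le
    have : (t : ℝ) ≤ u := by exact_mod_cast htu
    linarith
  have := abs_sum_mul_le_of_bounded (hKpos 0).le hmono hC T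
  refine le_trans (le_of_eq ?_) this
  congr 1
  refine Finset.sum_congr rfl fun t _ => ?_
  rw [h0 t]
  simp only [Pi.mul_apply, Pi.zero_apply, sub_zero, hg, he]
  field_simp [(hKpos (t + 1)).ne']

end Excitation

/-! ### Deterministic bounds for cross terms and thinned forms. -/

section Design

variable {n : ℕ}

/-- Cross terms between predictable regressors `ζ` and the noise `y` are dominated up to the
self-normalised size `L` of the noise. -/
theorem sum_sq_add_two_mul_ge {ζ y : ℕ → Fin n → ℝ} {T : ℕ} {L : ℝ} (hL : 0 < L)
    (h : ∀ j, selfNorm ζ (fun t => y t j) T ≤ L) (v : Fin n → ℝ) :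
    -(((n : ℝ) + 1) ^ 2 * L + 1) * (v ⬝ᵥ v) ≤
      ∑ t ∈ Finset.range T, ((v ⬝ᵥ ζ t) ^ 2 + 2 * ((v ⬝ᵥ ζ t) * (v ⬝ᵥ y t))) := by
  set S := ∑ t ∈ Finset.range T, (v ⬝ᵥ ζ t) ^ 2 with hS
  have hS0 : 0 ≤ S := Finset.sum_nonneg fun _ _ => sq_nonneg _
  have hvv := dotProduct_self_nonneg_real v
  have hcross : ∑ t ∈ Finset.range T, (v ⬝ᵥ ζ t) * (v ⬝ᵥ y t) =
      ∑ j, v j * (v ⬝ᵥ corr ζ (fun t => y t j) T) := by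
    have h1 : ∀ j, v j * (v ⬝ᵥ corr ζ (fun t => y t j) T) =
        ∑ t ∈ Finset.range T, v j * (y t j * (v ⬝ᵥ ζ t)) := fun j => by
      rw [corr, dotProduct_sum, Finset.mul_sum]
      simp only [dotProduct_smul, smul_eq_mul]
    simp_rw [h1]
    rw [Finset.sum_comm]
    refine Finset.sum_congr rfl fun t _ => ?_
    rw [show v ⬝ᵥ y t = ∑ j, v j * y t j from rfl, Finset.mul_sum]
    exact Finset.sum_congr rfl fun j _ => by ring
  have hn : (0 : ℝ) < n + 1 := by positivity
  -- Weighted AM-GM: each of the n coordinates spends a fraction 1/(n+1) of v·v + S, so the total is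
  -- paid by the squares S and one extra v·v.
  have hterm : ∀ j, -(((n : ℝ) + 1) * L * v j ^ 2 + (v ⬝ᵥ v + S) / (n + 1)) ≤
      2 * (v j * (v ⬝ᵥ corr ζ (fun t => y t j) T)) := fun j => by
    set b := v ⬝ᵥ corr ζ (fun t => y t j) T
    have h1 : b ^ 2 ≤ (v ⬝ᵥ v + S) * L := by
      have h2 := dotProduct_corr_sq_le ζ (fun t => y t j) T v
      rw [dotProduct_gram_mulVec] at h2
      exact h2.trans (mul_le_mul_of_nonneg_left (h j) (by positivity))
    have h3 : b ^ 2 / ((n + 1) * L) ≤ (v ⬝ᵥ v + S) / (n + 1) := by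
      rw [div_le_div_iff₀ (by positivity) hn]
      nlinarith
    have h4 : 0 ≤ ((n + 1) * L * v j + b) ^ 2 / ((n + 1) * L) := by positivity
    have h5 : ((n + 1) * L * v j + b) ^ 2 / ((n + 1) * L) =
        (n + 1) * L * v j ^ 2 + 2 * (v j * b) + b ^ 2 / ((n + 1) * L) := by
      field_simp; ring
    linarith
  have hsum := Finset.sum_le_sum fun j (_ : j ∈ Finset.univ) => hterm j
  rw [Finset.sum_neg_distrib, Finset.sum_add_distrib, ← Finset.mul_sum, ← Finset.mul_sum, ← hcross,
    Finset.sum_const, Finset.card_univ, Fintype.card_fin, nsmul_eq_mul] at hsum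
  have hv2 : ∑ j, v j ^ 2 = v ⬝ᵥ v := by simp only [dotProduct, pow_two]
  have h6 : (n : ℝ) * ((v ⬝ᵥ v + S) / (n + 1)) ≤ v ⬝ᵥ v + S := by
    rw [mul_div_assoc', div_le_iff₀ hn]
    nlinarith
  have h7 : ((n : ℝ) + 1) * L * (v ⬝ᵥ v) ≤ ((n : ℝ) + 1) ^ 2 * L * (v ⬝ᵥ v) := by
    have hn2 : (n : ℝ) + 1 ≤ ((n : ℝ) + 1) ^ 2 := by nlinarith [n.cast_nonneg (α := ℝ)]
    exact mul_le_mul_of_nonneg_right (mul_le_mul_of_nonneg_right hn2 hL.le) hvv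
  rw [Finset.sum_add_distrib, ← Finset.mul_sum]
  rw [hv2] at hsum
  linarith

/-- A thinned quadratic form differs little from a fraction of the full one. -/
theorem thinned_sum_sq_ge {y : ℕ → Fin n → ℝ} {ι : ℕ → ℝ} {T : ℕ} {q e : ℝ}
    (h : ∀ a b, |∑ t ∈ Finset.range T, (ι t - q) * (y t a * y t b)| ≤ e) (v : Fin n → ℝ) :
    q * ∑ t ∈ Finset.range T, (v ⬝ᵥ y t) ^ 2 - n * e * (v ⬝ᵥ v) ≤
      ∑ t ∈ Finset.range T, ι t * (v ⬝ᵥ y t) ^ 2 := by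
  have h1 : ∑ t ∈ Finset.range T, ι t * (v ⬝ᵥ y t) ^ 2 - q * ∑ t ∈ Finset.range T, (v ⬝ᵥ y t) ^ 2 =
      ∑ a, ∑ b, v a * v b * ∑ t ∈ Finset.range T, (ι t - q) * (y t a * y t b) := by
    rw [Finset.mul_sum, ← Finset.sum_sub_distrib]
    simp_rw [Finset.mul_sum]
    have : ∀ t, ι t * (v ⬝ᵥ y t) ^ 2 - q * (v ⬝ᵥ y t) ^ 2 =
        ∑ a, ∑ b, v a * v b * ((ι t - q) * (y t a * y t b)) := fun t => by
      rw [← sub_mul, pow_two, show v ⬝ᵥ y t = ∑ j, v j * y t j from rfl, Finset.sum_mul_sum,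
        Finset.mul_sum]
      refine Finset.sum_congr rfl fun a _ => ?_
      rw [Finset.mul_sum]
      exact Finset.sum_congr rfl fun b _ => by ring
    simp_rw [this]
    rw [Finset.sum_comm]
    exact Finset.sum_congr rfl fun a _ => Finset.sum_comm
  have h2 : |∑ a, ∑ b, v a * v b * ∑ t ∈ Finset.range T, (ι t - q) * (y t a * y t b)| ≤
      ∑ a, ∑ b, (v a ^ 2 + v b ^ 2) / 2 * e := by
    refine (Finset.abs_sum_le_sum_abs _ _).trans (Finset.sum_le_sum fun a _ => ?_)
    refine (Finset.abs_sum_le_sum_abs _ _).trans (Finset.sum_le_sum fun b _ => ?_)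
    rw [abs_mul]
    refine mul_le_mul ?_ (h a b) (abs_nonneg _) (by positivity)
    rw [abs_le]
    constructor <;> nlinarith [sq_nonneg (v a + v b), sq_nonneg (v a - v b)]
  have h3 : ∑ a, ∑ b, (v a ^ 2 + v b ^ 2) / 2 * e = n * e * (v ⬝ᵥ v) := by
    simp only [dotProduct, ← pow_two, ← Finset.sum_mul, ← Finset.sum_div, Finset.sum_add_distrib,
      Finset.sum_const, Finset.card_univ, Fintype.card_fin, nsmul_eq_mul, ← Finset.mul_sum]
    ring
  rw [h3] at h2
  linarith [(abs_le.1 h2).1]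

end Design

/-! ### Linear growth of the Gram matrix of each mode. -/

section LowerBound

variable {Ω : Type*} [mΩ : MeasurableSpace Ω] {μ : Measure Ω} {n k : ℕ}
  {A : Fin k → Matrix (Fin n) (Fin n) ℝ} {p : Fin k → ℝ} {x₀ : EuclideanSpace ℝ (Fin n)}
  {s : ℕ → Ω → Fin k} {x w : ℕ → Ω → EuclideanSpace ℝ (Fin n)}

theorem sum_visits_eq {Ω : Type*} {k : ℕ} (s : ℕ → Ω → Fin k) (i : Fin k) (T : ℕ) (ω : Ω)
    (f : ℕ → ℝ) :
    ∑ t ∈ visits s i T ω, f t = ∑ t ∈ Finset.range (T + 1), if s t ω = i then f t else 0 := by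
  rw [visits, Finset.sum_filter]

/-- Dropping time 0 leaves states of the form x_{t+1}, to which the dynamics apply. -/
theorem sum_visits_ge {Ω : Type*} {k : ℕ} (s : ℕ → Ω → Fin k) (i : Fin k) (T : ℕ) (ω : Ω)
    {f : ℕ → ℝ} (hf : ∀ t, 0 ≤ f t) :
    ∑ t ∈ Finset.range T, (if s (t + 1) ω = i then 1 else 0) * f (t + 1) ≤
      ∑ t ∈ visits s i T ω, f t := by
  rw [sum_visits_eq, Finset.sum_range_succ']
  have h0 : 0 ≤ if s 0 ω = i then f 0 else 0 := by split_ifs <;> simp [hf]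
  have : ∀ t, (if s (t + 1) ω = i then (1 : ℝ) else 0) * f (t + 1) =
      if s (t + 1) ω = i then f (t + 1) else 0 := fun t => by split_ifs <;> simp
  simp_rw [this]
  linarith

theorem abs_coord_le {n : ℕ} (v : EuclideanSpace ℝ (Fin n)) (j : Fin n) : |v j| ≤ ‖v‖ :=
  PiLp.norm_apply_le v j

variable [IsProbabilityMeasure μ] {hsys : IsSwitchedLinearSystem μ A p x₀ s x w} {α : ℝ}
  {M : ℝ≥0∞} {w' : ℕ → Ω → EuclideanSpace ℝ (Fin n)}

/-- For predictable regressors dominated by the state, the self-normalised noise is of logarithmic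
size. -/
theorem IsLocalNoise.ae_selfNorm_le_log (hw : IsLocalNoise hsys α M w')
    (hstab : StabilityAssumption A p) {z : ℕ → Ω → Fin n → ℝ}
    (hz : ∀ t j, Measurable[hsys.enlargedHistory t] fun ω => z t ω j) {R : ℝ} (hR : 0 ≤ R)
    (hzx : ∀ t ω j, |z t ω j| ≤ R * ‖x t ω‖) :
    ∀ᵐ ω ∂μ, (∀ t, w' t ω = w t ω) → ∃ D, 0 ≤ D ∧ ∀ T : ℕ, 2 ≤ T → ∀ N ≤ T + 1, ∀ j,
      selfNorm (fun t => z t ω) (fun t => w t ω j) N ≤ D * Real.log T := by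
  filter_upwards [ae_all_iff.2 fun j => (hw.isNoise j).ae_selfNorm_le hw.two_lt hw.le_four
    hw.ne_top hz, hw.ae_state_le hstab] with ω h1 h2 heq
  obtain ⟨C, κ, hx⟩ := h2 heq
  choose E hE0 hE using h1
  obtain ⟨D, hD0, hD⟩ := exists_log_det_gram_le (z := fun t => z t ω) (C := R * C) (κ := κ)
    fun t j => by
      refine (hzx t ω j).trans ?_
      rw [mul_assoc]
      exact mul_le_mul_of_nonneg_left (hx t) hR
  refine ⟨(∑ j, E j) * D, mul_nonneg (Finset.sum_nonneg fun j _ => hE0 j) hD0,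
    fun T hT N hN j => ?_⟩
  have h3 := hE j N
  simp_rw [heq] at h3
  refine h3.trans ?_
  have h4 : E j ≤ ∑ j, E j := Finset.single_le_sum (fun j _ => hE0 j) (Finset.mem_univ j)
  have h5 := hD T hT N hN
  have h6 : 0 ≤ D * Real.log T :=
    mul_nonneg hD0 (Real.log_nonneg (by exact_mod_cast (by omega : 1 ≤ T)))
  rw [mul_assoc]
  exact (mul_le_mul_of_nonneg_left h5 (hE0 j)).trans (mul_le_mul_of_nonneg_right h4 h6)

theorem tendsto_log_div_nat : Tendsto (fun T : ℕ => Real.log T / T) atTop (𝓝 0) := by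
  have h := (Real.isLittleO_log_id_atTop.comp_tendsto tendsto_natCast_atTop_atTop).tendsto_div_nhds_zero
  exact h

theorem tendsto_rpow_div_nat {κ : ℝ} (hκ : κ < 1) :
    Tendsto (fun T : ℕ => ((T : ℝ) + 1) ^ κ / T) atTop (𝓝 0) := by
  have h1 : Tendsto (fun T : ℕ => ((T : ℝ) + 1) ^ (-(1 - κ))) atTop (𝓝 0) :=
    (tendsto_rpow_neg_atTop (by linarith)).comp
      (tendsto_atTop_add_const_right _ _ tendsto_natCast_atTop_atTop)
  have h2 : Tendsto (fun T : ℕ => 2 * ((T : ℝ) + 1) ^ (-(1 - κ))) atTop (𝓝 0) := by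
    simpa using h1.const_mul 2
  refine squeeze_zero' (Eventually.of_forall fun T => by positivity) ?_ h2
  filter_upwards [eventually_ge_atTop 1] with T hT
  have hT' : (1 : ℝ) ≤ T := by exact_mod_cast hT
  have h3 : ((T : ℝ) + 1) ^ κ = ((T : ℝ) + 1) ^ (-(1 - κ)) * (T + 1) := by
    rw [← Real.rpow_add_one (by positivity)]; congr 1; ring
  rw [h3, div_le_iff₀ (by linarith)]
  have h4 : 0 ≤ ((T : ℝ) + 1) ^ (-(1 - κ)) := by positivity
  nlinarith

/-- The regressors of each mode are excited linearly in time, uniformly in the direction. -/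
theorem IsLocalNoise.ae_design_ge (hw : IsLocalNoise hsys α M w') (hstab : StabilityAssumption A p)
    (hnoise : NoiseAssumption μ s x w) (i : Fin k) :
    ∀ᵐ ω ∂μ, (∀ t, w' t ω = w t ω) → ∃ c > 0, ∀ᶠ T : ℕ in atTop, ∀ v : Fin n → ℝ,
      c * T * (v ⬝ᵥ v) ≤ ∑ t ∈ visits s i T ω, (v ⬝ᵥ (x t ω).ofLp) ^ 2 := by
  -- The part of x_{t+1} known before w_t, masked by the visit at t + 1; it is predictable only for
  -- the enlarged history.
  set ζ : ℕ → Ω → Fin n → ℝ := fun t ω =>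
    (if s (t + 1) ω = i then (1 : ℝ) else 0) • (act (A (s t ω)) (x t ω)).ofLp with hζ
  have hζm : ∀ t j, Measurable[hsys.enlargedHistory t] fun ω => ζ t ω j := fun t j => by
    have h1 : Measurable[hsys.enlargedHistory t] fun ω => act (A (s t ω)) (x t ω) :=
      measurable_act_mode ((measurable_mode_history le_rfl).mono le_sup_left le_rfl)
        ((measurable_state_history le_rfl).mono le_sup_left le_rfl)
    have h2 : Measurable[hsys.enlargedHistory t] fun ω => if s (t + 1) ω = i then (1 : ℝ) else 0 :=
      (measurable_of_finite fun l : Fin k => if l = i then (1 : ℝ) else 0).comp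
        ((comap_measurable (s (t + 1))).mono le_sup_right le_rfl)
    exact h2.mul ((EuclideanSpace.proj (𝕜 := ℝ) j).continuous.measurable.comp h1)
  have hζx : ∀ t ω j, |ζ t ω j| ≤ (∑ l, sigmaMax (A l)) * ‖x t ω‖ := fun t ω j => by
    have h1 : |ζ t ω j| ≤ |(act (A (s t ω)) (x t ω)) j| := by
      simp only [hζ, Pi.smul_apply, smul_eq_mul]
      split_ifs <;> simp
    refine h1.trans ((abs_coord_le _ j).trans (((act (A (s t ω))).le_opNorm _).trans ?_))
    refine mul_le_mul_of_nonneg_right ?_ (norm_nonneg _)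
    exact Finset.single_le_sum (f := fun l => sigmaMax (A l)) (fun l _ => sigmaMax_nonneg _)
      (Finset.mem_univ (s t ω))
  choose κ hκ hthin using hw.ae_thinned_cov_sub_le i
  filter_upwards [hw.ae_selfNorm_le_log hstab hζm
    (Finset.sum_nonneg fun l _ => sigmaMax_nonneg _) hζx, hw.ae_sum_sq_le, hnoise.ae_excitation,
    ae_all_iff.2 fun a => ae_all_iff.2 fun b => hthin a b] with ω h1 h2 h3 h4 heq
  obtain ⟨D, hD0, hD⟩ := h1 heq
  obtain ⟨W, hW⟩ := h2
  simp_rw [heq] at hW h4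
  choose E hE using h4
  obtain ⟨c, hc, hexc⟩ := exists_uniform_excitation hW h3
  have hp := hsys.prob_pos i
  -- The exponent κ depends on the entry, so the errors are summed to dominate every entry at once.
  set err : ℕ → ℝ := fun T => ∑ a, ∑ b, |E a b| * ((T : ℝ) + 1) ^ κ a b with herr
  have hlim : Tendsto (fun T : ℕ => n * (err T / T) + ((n : ℝ) + 1) ^ 2 * ((D + 1) * (Real.log T / T))
      + 1 / T) atTop (𝓝 0) := by
    have e1 : Tendsto (fun T : ℕ => err T / T) atTop (𝓝 0) := by
      simp only [herr, Finset.sum_div, mul_div_assoc]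
      have : (0 : ℝ) = ∑ a : Fin n, ∑ b : Fin n, |E a b| * 0 := by simp
      rw [this]
      exact tendsto_finsetSum _ fun a _ => tendsto_finsetSum _ fun b _ =>
        (tendsto_rpow_div_nat (hκ a b)).const_mul _
    have e2 := ((tendsto_log_div_nat.const_mul (D + 1)).const_mul (((n : ℝ) + 1) ^ 2))
    simpa using ((e1.const_mul (n : ℝ)).add e2).add tendsto_one_div_atTop_nhds_zero_nat
  -- The thinned noise contributes p_i c T; thinning and cross-term errors are eventually below half
  -- of it.
  refine ⟨p i * c / 2, by positivity, ?_⟩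
  filter_upwards [hexc, hlim.eventually_lt_const (show 0 < p i * c / 2 by positivity),
    eventually_ge_atTop 2] with T hT hsmall hT2 v
  have hT2' : (2 : ℝ) ≤ T := by exact_mod_cast hT2
  have hlog : 0 < Real.log T := Real.log_pos (by linarith)
  have hvv := dotProduct_self_nonneg_real v
  have hcross := sum_sq_add_two_mul_ge (ζ := fun t => ζ t ω) (y := fun t => (w t ω).ofLp) (T := T)
    (L := (D + 1) * Real.log T) (by positivity)
    (fun j => (hD T hT2 T T.le_succ j).trans (by nlinarith)) v
  have hth := thinned_sum_sq_ge (y := fun t => (w t ω).ofLp)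
    (ι := fun t => if s (t + 1) ω = i then 1 else 0) (T := T) (q := p i) (e := err T)
    (fun a b => (hE a b T).trans (by
      refine (mul_le_mul_of_nonneg_right (le_abs_self _) (by positivity)).trans ?_
      refine le_trans ?_ (Finset.single_le_sum
        (f := fun a => ∑ b, |E a b| * ((T : ℝ) + 1) ^ κ a b)
        (fun a _ => Finset.sum_nonneg fun b _ => by positivity) (Finset.mem_univ a))
      exact Finset.single_le_sum (f := fun b => |E a b| * ((T : ℝ) + 1) ^ κ a b)
        (fun b _ => by positivity) (Finset.mem_univ b))) v
  refine le_trans ?_ (sum_visits_ge s i T ω fun t => sq_nonneg (v ⬝ᵥ (x t ω).ofLp))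
  have hexp : ∀ t, (if s (t + 1) ω = i then (1 : ℝ) else 0) * (v ⬝ᵥ (x (t + 1) ω).ofLp) ^ 2 =
      ((v ⬝ᵥ ζ t ω) ^ 2 + 2 * ((v ⬝ᵥ ζ t ω) * (v ⬝ᵥ (w t ω).ofLp)))
        + (if s (t + 1) ω = i then (1 : ℝ) else 0) * (v ⬝ᵥ (w t ω).ofLp) ^ 2 := fun t => by
    rw [hsys.dynamics, WithLp.ofLp_add, dotProduct_add]
    simp only [hζ, dotProduct_smul, smul_eq_mul]
    split_ifs <;> ring
  simp_rw [hexp]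
  rw [Finset.sum_add_distrib]
  have h5 := mul_le_mul_of_nonneg_left (hT v) hp.le
  have hTpos : (0 : ℝ) < T := by linarith
  have h6 : n * err T + ((n : ℝ) + 1) ^ 2 * ((D + 1) * Real.log T) + 1 ≤ p i * c / 2 * T := by
    have : n * err T + ((n : ℝ) + 1) ^ 2 * ((D + 1) * Real.log T) + 1 =
        (n * (err T / T) + ((n : ℝ) + 1) ^ 2 * ((D + 1) * (Real.log T / T)) + 1 / T) * T := by
      field_simp
    rw [this]
    exact mul_le_mul_of_nonneg_right hsmall.le hTpos.le
  have h7 := mul_le_mul_of_nonneg_right h6 hvv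
  nlinarith

end LowerBound

/-! ### Error inequality for least squares. -/

section Estimator

variable {n : ℕ}

theorem act_apply (B : Matrix (Fin n) (Fin n) ℝ) (v : EuclideanSpace ℝ (Fin n)) (j : Fin n) :
    act B v j = B j ⬝ᵥ v.ofLp := rfl

theorem norm_sq_eq_sum (v : EuclideanSpace ℝ (Fin n)) : ‖v‖ ^ 2 = ∑ j, v j ^ 2 := by
  simp [EuclideanSpace.norm_sq_eq]

/-- The prediction error of a least squares estimate is controlled by the correlation of the noise
with the regressors. -/
theorem sum_sq_error_le {N : Finset ℕ} {x y : ℕ → EuclideanSpace ℝ (Fin n)}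
    {A B : Matrix (Fin n) (Fin n) ℝ}
    (h : ∑ t ∈ N, ‖act A (x t) + y t - act B (x t)‖ ^ 2 ≤
      ∑ t ∈ N, ‖act A (x t) + y t - act A (x t)‖ ^ 2) :
    ∑ j, ∑ t ∈ N, ((B - A) j ⬝ᵥ (x t).ofLp) ^ 2 ≤
      ∑ j, 2 * ∑ t ∈ N, y t j * ((B - A) j ⬝ᵥ (x t).ofLp) := by
  have h1 : ∀ t, ‖act A (x t) + y t - act B (x t)‖ ^ 2 = ‖act A (x t) + y t - act A (x t)‖ ^ 2 +
      (∑ j, ((B - A) j ⬝ᵥ (x t).ofLp) ^ 2 - ∑ j, 2 * (y t j * ((B - A) j ⬝ᵥ (x t).ofLp))) := by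
    intro t
    rw [norm_sq_eq_sum, norm_sq_eq_sum, ← Finset.sum_sub_distrib, ← Finset.sum_add_distrib]
    refine Finset.sum_congr rfl fun j _ => ?_
    have h2 : (B - A) j ⬝ᵥ (x t).ofLp = B j ⬝ᵥ (x t).ofLp - A j ⬝ᵥ (x t).ofLp := by
      rw [← sub_dotProduct]; rfl
    rw [h2]
    simp only [PiLp.sub_apply, PiLp.add_apply, act_apply]
    ring
  simp_rw [h1] at h
  rw [Finset.sum_add_distrib, Finset.sum_sub_distrib] at h
  rw [Finset.sum_comm]
  have h3 : ∑ j, 2 * ∑ t ∈ N, y t j * ((B - A) j ⬝ᵥ (x t).ofLp) =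
      ∑ t ∈ N, ∑ j, 2 * (y t j * ((B - A) j ⬝ᵥ (x t).ofLp)) := by
    simp_rw [Finset.mul_sum]
    exact Finset.sum_comm
  rw [h3]
  linarith

theorem maxEntry_sq_le (B : Matrix (Fin n) (Fin n) ℝ) : maxEntry B ^ 2 ≤ ∑ j, B j ⬝ᵥ B j := by
  have h0 : 0 ≤ ∑ j, B j ⬝ᵥ B j := Finset.sum_nonneg fun j _ => dotProduct_self_nonneg_real _
  have hle : maxEntry B ≤ Real.sqrt (∑ j, B j ⬝ᵥ B j) := by
    refine Real.iSup_le (fun e => Real.abs_le_sqrt ?_) (Real.sqrt_nonneg _)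
    calc B e.1 e.2 ^ 2 = B e.1 e.2 * B e.1 e.2 := pow_two _
      _ ≤ B e.1 ⬝ᵥ B e.1 := Finset.single_le_sum (f := fun l => B e.1 l * B e.1 l)
          (fun _ _ => mul_self_nonneg _) (Finset.mem_univ e.2)
      _ ≤ _ := Finset.single_le_sum (f := fun j => B j ⬝ᵥ B j)
          (fun j _ => dotProduct_self_nonneg_real _) (Finset.mem_univ e.1)
  have hnn : 0 ≤ maxEntry B := Real.iSup_nonneg fun e => abs_nonneg _
  calc maxEntry B ^ 2 ≤ Real.sqrt (∑ j, B j ⬝ᵥ B j) ^ 2 := pow_le_pow_left₀ hnn hle 2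
    _ = _ := Real.sq_sqrt h0

/-- Error bound for least squares with regressors `z`, noise of self-normalised size `L` and a Gram
matrix bounded below by `m ≥ 1`. -/
theorem sum_error_sq_le {z y : ℕ → Fin n → ℝ} {N : ℕ} {E : Matrix (Fin n) (Fin n) ℝ} {L m : ℝ}
    (hm : 1 ≤ m) (hL : 0 ≤ L) (hq : ∀ j, selfNorm z (fun t => y t j) N ≤ L)
    (hX : ∀ v : Fin n → ℝ, m * (v ⬝ᵥ v) ≤ ∑ t ∈ Finset.range N, (v ⬝ᵥ z t) ^ 2)
    (h : ∑ j, ∑ t ∈ Finset.range N, (E j ⬝ᵥ z t) ^ 2 ≤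
      ∑ j, 2 * ∑ t ∈ Finset.range N, y t j * (E j ⬝ᵥ z t)) :
    m * ∑ j, E j ⬝ᵥ E j ≤ 8 * n * L := by
  have hterm : ∀ j, 2 * ∑ t ∈ Finset.range N, y t j * (E j ⬝ᵥ z t) ≤
      (∑ t ∈ Finset.range N, (E j ⬝ᵥ z t) ^ 2) / 2 + 4 * L := fun j => by
    set D := ∑ t ∈ Finset.range N, (E j ⬝ᵥ z t) ^ 2 with hD
    have hD0 : 0 ≤ D := Finset.sum_nonneg fun _ _ => sq_nonneg _
    have h1 : ∑ t ∈ Finset.range N, y t j * (E j ⬝ᵥ z t) = E j ⬝ᵥ corr z (fun t => y t j) N := by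
      rw [corr, dotProduct_sum]
      simp only [dotProduct_smul, smul_eq_mul]
    have h2 := dotProduct_corr_sq_le z (fun t => y t j) N (E j)
    rw [dotProduct_gram_mulVec, ← hD, ← h1] at h2
    have hee := dotProduct_self_nonneg_real (E j)
    -- Here m ≥ 1 absorbs the regularising identity of the Gram matrix into the data. Then 8DL ≤
    -- (D/2 + 4L)², and the remaining half of D yields the factor 8.
    have h3 : E j ⬝ᵥ E j + D ≤ 2 * D := by nlinarith [hX (E j)]
    have h4 : (E j ⬝ᵥ E j + D) * selfNorm z (fun t => y t j) N ≤ 2 * D * L :=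
      mul_le_mul h3 (hq j) (selfNorm_nonneg _ _ _) (by positivity)
    have h5 : 0 ≤ D / 2 + 4 * L := by positivity
    refine (abs_le_of_sq_le_sq' ?_ h5).2
    nlinarith [sq_nonneg (D / 2 - 4 * L)]
  have h1 := Finset.sum_le_sum fun j (_ : j ∈ Finset.univ) => hterm j
  rw [Finset.sum_add_distrib, ← Finset.sum_div, Finset.sum_const, Finset.card_univ,
    Fintype.card_fin, nsmul_eq_mul] at h1
  have h2 := Finset.sum_le_sum fun j (_ : j ∈ Finset.univ) => hX (E j)
  rw [← Finset.mul_sum] at h2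
  linarith

end Estimator

/-! ### The almost sure rate. -/

section Rate

variable {Ω : Type*} [mΩ : MeasurableSpace Ω] {μ : Measure Ω} [IsProbabilityMeasure μ] {n k : ℕ}
  {A : Fin k → Matrix (Fin n) (Fin n) ℝ} {p : Fin k → ℝ} {x₀ : EuclideanSpace ℝ (Fin n)}
  {s : ℕ → Ω → Fin k} {x w : ℕ → Ω → EuclideanSpace ℝ (Fin n)}
  {hsys : IsSwitchedLinearSystem μ A p x₀ s x w} {α : ℝ} {M : ℝ≥0∞}
  {w' : ℕ → Ω → EuclideanSpace ℝ (Fin n)}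

theorem IsLocalNoise.ae_error_isBigO (hw : IsLocalNoise hsys α M w')
    (hstab : StabilityAssumption A p) (hnoise : NoiseAssumption μ s x w)
    {Ahat : Fin k → ℕ → Ω → Matrix (Fin n) (Fin n) ℝ} (hls : IsSwitchedLeastSquares x s Ahat)
    (i : Fin k) :
    ∀ᵐ ω ∂μ, (∀ t, w' t ω = w t ω) →
      (fun T : ℕ => maxEntry (Ahat i T ω - A i)) =O[atTop]
        (fun T : ℕ => Real.sqrt (Real.log (T : ℝ) / ((visits s i T ω).card : ℝ))) := by
  set z : ℕ → Ω → Fin n → ℝ := fun t ω => (if s t ω = i then (1 : ℝ) else 0) • (x t ω).ofLp with hz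
  have hzm : ∀ t j, Measurable[hsys.enlargedHistory t] fun ω => z t ω j := fun t j => by
    have h1 : Measurable[hsys.enlargedHistory t] (x t) :=
      (measurable_state_history le_rfl).mono le_sup_left le_rfl
    have h2 : Measurable[hsys.enlargedHistory t] fun ω => if s t ω = i then (1 : ℝ) else 0 :=
      (measurable_of_finite fun l : Fin k => if l = i then (1 : ℝ) else 0).comp
        ((measurable_mode_history le_rfl).mono le_sup_left le_rfl)
    exact h2.mul ((EuclideanSpace.proj (𝕜 := ℝ) j).continuous.measurable.comp h1)
  have hzx : ∀ t ω j, |z t ω j| ≤ 1 * ‖x t ω‖ := fun t ω j => by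
    have h1 : |z t ω j| ≤ |x t ω j| := by
      simp only [hz, Pi.smul_apply, smul_eq_mul]
      split_ifs <;> simp
    rw [one_mul]
    exact h1.trans (abs_coord_le _ j)
  filter_upwards [hw.ae_selfNorm_le_log hstab hzm zero_le_one hzx,
    hw.ae_design_ge hstab hnoise i] with ω h1 h2 heq
  obtain ⟨D, hD0, hD⟩ := h1 heq
  obtain ⟨c, hc, hdes⟩ := h2 heq
  have hvis : ∀ T (f : ℕ → ℝ) (g : ℕ → ℝ), (∀ t, (if s t ω = i then f t else 0) = g t) →
      ∑ t ∈ visits s i T ω, f t = ∑ t ∈ Finset.range (T + 1), g t := fun T f g hfg => by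
    rw [sum_visits_eq]; exact Finset.sum_congr rfl fun t _ => hfg t
  -- The error bound gives 8nD/c times log T / T; the other factor 2 is from replacing T by the
  -- number of visits, which is at most 2T.
  refine IsBigO.of_bound (Real.sqrt (16 * n * D / c)) ?_
  have hcT : ∀ᶠ T : ℕ in atTop, 1 ≤ c * (T : ℝ) :=
    (tendsto_natCast_atTop_atTop.const_mul_atTop hc).eventually_ge_atTop 1
  filter_upwards [hdes, hcT, eventually_ge_atTop 2] with T hT hcT hT2
  have hT2' : (2 : ℝ) ≤ T := by exact_mod_cast hT2
  have hlog : 0 < Real.log T := Real.log_pos (by linarith)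
  have hmin := hls i T ω (Set.mem_univ (A i))
  simp only [Set.mem_ofPred_eq, lsLoss] at hmin
  have hdyn : ∀ B : Matrix (Fin n) (Fin n) ℝ,
      ∑ t ∈ visits s i T ω, ‖x (t + 1) ω - act B (x t ω)‖ ^ 2 =
        ∑ t ∈ visits s i T ω, ‖act (A i) (x t ω) + w t ω - act B (x t ω)‖ ^ 2 := fun B => by
    refine Finset.sum_congr rfl fun t ht => ?_
    rw [hsys.dynamics, (Finset.mem_filter.1 ht).2]
  rw [hdyn, hdyn] at hmin
  have herr := sum_sq_error_le hmin
  set E := Ahat i T ω - A i with hE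
  have hbound : c * T * ∑ j, E j ⬝ᵥ E j ≤ 8 * n * (D * Real.log T) := by
    refine sum_error_sq_le (z := fun t => z t ω) (y := fun t => (w t ω).ofLp) (N := T + 1) hcT
      (by positivity) (fun j => hD T hT2 (T + 1) le_rfl j) (fun v => ?_) ?_
    · refine (hT v).trans (le_of_eq (hvis T _ _ fun t => ?_))
      simp only [hz, dotProduct_smul, smul_eq_mul]
      split_ifs <;> simp
    · refine le_trans (le_of_eq ?_) (herr.trans (le_of_eq ?_))
      · refine Finset.sum_congr rfl fun j _ => (hvis T _ _ fun t => ?_).symm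
        simp only [hz, dotProduct_smul, smul_eq_mul]
        split_ifs <;> simp
      · refine Finset.sum_congr rfl fun j _ => congrArg _ (hvis T _ _ fun t => ?_)
        simp only [hz, dotProduct_smul, smul_eq_mul]
        split_ifs <;> simp
  have hnn : 0 ≤ maxEntry E := Real.iSup_nonneg fun e => abs_nonneg _
  rw [Real.norm_of_nonneg hnn, Real.norm_of_nonneg (Real.sqrt_nonneg _),
    ← Real.sqrt_mul (by positivity)]
  refine Real.le_sqrt_of_sq_le ((maxEntry_sq_le E).trans ?_)
  rcases Nat.eq_zero_or_pos n with rfl | hn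
  · simp
  -- Without visits the quotient would be 0 by convention; the design bound in a coordinate
  -- direction, available since n > 0, excludes this.
  have hcard : (0 : ℝ) < (visits s i T ω).card := by
    rw [Nat.cast_pos, Finset.card_pos, Finset.nonempty_iff_ne_empty]
    intro h0
    have h3 := hT (Pi.single ⟨0, hn⟩ 1)
    rw [h0] at h3
    simp only [dotProduct_single, Pi.single_eq_same, mul_one, Finset.sum_empty] at h3
    linarith
  have hcard' : ((visits s i T ω).card : ℝ) ≤ 2 * T := by
    have h3 : (visits s i T ω).card ≤ T + 1 := by
      simpa [visits] using Finset.card_filter_le (Finset.range (T + 1)) fun t => s t ω = i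
    have h4 : ((visits s i T ω).card : ℝ) ≤ T + 1 := by exact_mod_cast h3
    linarith
  have hcTpos : 0 < c * (T : ℝ) := by linarith
  rw [div_mul_div_comm, le_div_iff₀ (by positivity)]
  have hS : 0 ≤ ∑ j, E j ⬝ᵥ E j := Finset.sum_nonneg fun j _ => dotProduct_self_nonneg_real _
  have h5 := mul_le_mul_of_nonneg_left hcard' (mul_nonneg hc.le hS)
  nlinarith

end Rate

end SwitchedLS

theorem corollary2 {Ω : Type*} [MeasurableSpace Ω] (μ : Measure Ω) [IsProbabilityMeasure μ]
    {n k : ℕ} (A : Fin k → Matrix (Fin n) (Fin n) ℝ) (p : Fin k → ℝ)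
    (x₀ : EuclideanSpace ℝ (Fin n)) (s : ℕ → Ω → Fin k)
    (x w : ℕ → Ω → EuclideanSpace ℝ (Fin n))
    (Ahat : Fin k → ℕ → Ω → Matrix (Fin n) (Fin n) ℝ)
    (hsys : SwitchedLS.IsSwitchedLinearSystem μ A p x₀ s x w)
    (hnoise : SwitchedLS.NoiseAssumption μ s x w)
    (hstab : SwitchedLS.StabilityAssumption A p)
    (hls : SwitchedLS.IsSwitchedLeastSquares x s Ahat) :
    ∀ i : Fin k, ∀ᵐ ω ∂μ,
      (fun T : ℕ => SwitchedLS.maxEntry (Ahat i T ω - A i)) =O[atTop]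
        (fun T : ℕ => Real.sqrt (Real.log (T : ℝ) / ((SwitchedLS.visits s i T ω).card : ℝ))) := by
  intro i
  -- Countably many truncation levels mean countably many null sets; each remaining path uses its
  -- own level m.
  obtain ⟨α, w', hw, hcover⟩ := SwitchedLS.exists_localNoise hsys hnoise
  filter_upwards [hcover, ae_all_iff.2 fun m => (hw m).ae_error_isBigO hstab hnoise hls i]
    with ω ⟨m, hm⟩ h
  exact h m hm
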